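/- Let $F$ be a non-abelian free group (of any rank, possibly infinite) and let $H_1,\dots,H_k$ be finitely generated subgroups of infinite index in $F$. For subgroups $A,B$ of a group $G$, say that $A$ is conjugate into $B$ if $gAg^{-1}\subseteq B$ for some $g\in G$. Then there exist a natural number $m$ and a surjective homomorphism $f\colon F\to A_m$ onto the alternating group of degree $m$ such that, for all $i,j$, if $H_i$ is not conjugate into $H_j$ (in $F$), then $f(H_i)$ is not conjugate into $f(H_j)$ (in $A_m$). Moreover, there exist a natural number $m'$ and a surjective homomorphism $f'\colon F\to S_{m'}$ onto the symmetric group of degree $m'$ such that, for all $i,j$, if $H_i$ is not conjugate into $H_j$ (in $F$), then $f'(H_i)$ is not conjugate into $f'(H_j)$ (in $S_{m'}$). -/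

import Mathlib

/-- `H` is conjugate into `K` in the ambient group `G`: some conjugate `g H g⁻¹` lies in `K`. -/
def Subgroup.IsConjInto {G : Type*} [Group G] (H K : Subgroup G) : Prop :=
  ∃ g : G, ∀ h ∈ H, g * h * g⁻¹ ∈ K

/-! Fix a prime `p` and call `v` a `p`-power point of `H` if every `h ∈ H` has some power `h ^ p ^
k` fixing `v`. A conjugation taking `f(H_i)` into `f(H_j)` turns `p`-power points of `H_j` into
`p`-power points of `H_i`. So it is enough to find an action with alternating or symmetric image and
primes `p_j` such that `H_j` has many orbits of `p_j`-power points, while an `H_i` not conjugate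
into `H_j` has too few.

Separation. A large finite piece of the Schreier graph of `H_j` is completed to a permutation action
and covered with voltages in a finite group. This gives `K_j` of finite index such that `H_j` fixes
many points of `F/K_j`, and no `H_i` not conjugate into `H_j` fixes any
(`FreeGroup.exists_finiteIndex_fixedPoints`). Each `K_j` is then cut down by a map to a finite
`p_j`-group, for distinct large primes `p_j`, and the coset spaces are put together
(`exists_separating_action`).

Large image. Two blocks are added on which one generator is almost a long cycle, together with one
extra point. After boundedly many changes, powers of two generators are cycles meeting in that point
only. Their commutator is a 3-cycle, one of them has prime length exceeding half the degree, and
Jordan's theorem applies (`exists_amalgam`). Every change damages a number of orbits bounded in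
advance, so enough survive (`not_conj_of_primePowerPoints`).

Arbitrary rank reduces to finite rank by a retraction that is injective on each `H_i` and keeps the
index infinite. -/

/-! ### Free groups are residually finite `p`-groups -/

namespace Matrix

/-- A matrix with ones on the diagonal and zeros below it. -/
def IsUpperUnitriangular {n : ℕ} {R : Type*} [CommRing R] (A : Matrix (Fin n) (Fin n) R) : Prop :=
  ∀ i j, j ≤ i → A i j = if i = j then 1 else 0

namespace IsUpperUnitriangular

variable {n : ℕ} {R : Type*} [CommRing R] {A B : Matrix (Fin n) (Fin n) R}

theorem one : IsUpperUnitriangular (1 : Matrix (Fin n) (Fin n) R) :=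
  fun _ _ _ => Matrix.one_apply

theorem mul (hA : A.IsUpperUnitriangular) (hB : B.IsUpperUnitriangular) :
    (A * B).IsUpperUnitriangular := by
  intro i j hij
  rw [Matrix.mul_apply, Finset.sum_eq_single i]
  · rw [hA i i le_rfl, hB i j hij]; simp
  · intro b _ hb
    rcases lt_or_gt_of_ne hb with h | h
    · rw [hA i b h.le, if_neg h.ne']; simp
    · rw [hB b j (hij.trans h.le), if_neg (hij.trans_lt h).ne']; simp
  · simp

/-- `N = A - 1` is nilpotent by Cayley–Hamilton, and in characteristic `p` the power `(1 + N) ^ p ^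
k` is `1 + N ^ p ^ k`. -/
theorem exists_pow_prime_pow_eq_one (p : ℕ) [Fact p.Prime] [CharP R p]
    (hA : A.IsUpperUnitriangular) : ∃ k, A ^ p ^ k = 1 := by
  rcases Nat.eq_zero_or_pos n with rfl | hn
  · exact ⟨0, Subsingleton.elim _ _⟩
  have : Nonempty (Fin n) := ⟨⟨0, hn⟩⟩
  have hnil : (A - 1) ^ n = 0 := by
    have htri : (A - 1).BlockTriangular id := by
      intro i j hij
      have hij : j < i := hij
      rw [Matrix.sub_apply, hA i j hij.le, if_neg hij.ne', Matrix.one_apply_ne hij.ne', sub_zero]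
    have h := Matrix.aeval_self_charpoly (A - 1)
    rw [Matrix.charpoly_of_isUpperTriangular _ htri] at h
    have hd : ∀ i, (A - 1) i i = 0 := fun i => by
      rw [Matrix.sub_apply, hA i i le_rfl]; simp
    simpa [hd] using h
  obtain ⟨k, hk⟩ : ∃ k, n ≤ p ^ k := ⟨n, (Nat.lt_pow_self (Fact.out : p.Prime).one_lt).le⟩
  refine ⟨k, ?_⟩
  have h := add_pow_char_pow_of_commute (p := p) (n := k) (Commute.one_left (A - 1))
  rw [add_sub_cancel, one_pow, pow_eq_zero_of_le hk hnil, add_zero] at h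
  exact h

end IsUpperUnitriangular

end Matrix

/-! ### Unitriangular matrices modulo `p` that detect a given word -/

namespace FreeGroup

section

variable {Y : Type*} [DecidableEq Y] (p : ℕ) (M : List (Y × Bool))

/-- The superdiagonal matrix marking the positions of the letter `c` in `M`. -/
def letterMatrix (c : Y) : Matrix (Fin (M.length + 1)) (Fin (M.length + 1)) (ZMod p) :=
  fun i j => if j.val = i.val + 1 ∧ (M[i.val]?).map Prod.fst = some c then 1 else 0

/-- A nonzero entry of the square would need the letter `c` at two adjacent positions of `M`. -/
theorem letterMatrix_mul_self (hM : M.IsChain fun a b => a.1 ≠ b.1) (c : Y) :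
    letterMatrix p M c * letterMatrix p M c = 0 := by
  ext i k
  rw [Matrix.mul_apply, Matrix.zero_apply]
  refine Finset.sum_eq_zero fun j _ => ?_
  unfold letterMatrix
  split_ifs with h1 h2 <;> try simp
  obtain ⟨hj, h1⟩ := h1
  obtain ⟨hk, h2⟩ := h2
  rw [hj] at h2
  simp only [Option.map_eq_some_iff] at h1 h2
  obtain ⟨a, ha, hac⟩ := h1
  obtain ⟨b, hb, hbc⟩ := h2
  rw [List.getElem?_eq_some_iff] at ha hb
  obtain ⟨ha1, ha⟩ := ha
  obtain ⟨hb1, hb⟩ := hb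
  have := List.isChain_iff_getElem.1 hM i.val hb1
  rw [ha, hb] at this
  exact (this (hac.trans hbc.symm)).elim

/-- The elementary unipotent attached to a letter. -/
def letterUnit (hM : M.IsChain fun a b => a.1 ≠ b.1) (c : Y) :
    (Matrix (Fin (M.length + 1)) (Fin (M.length + 1)) (ZMod p))ˣ where
  val := 1 + letterMatrix p M c
  inv := 1 - letterMatrix p M c
  val_inv := by
    have := letterMatrix_mul_self p M hM c
    linear_combination (norm := noncomm_ring) -this
  inv_val := by
    have := letterMatrix_mul_self p M hM c
    linear_combination (norm := noncomm_ring) -this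

theorem lift_letterUnit_isUpperUnitriangular (hM : M.IsChain fun a b => a.1 ≠ b.1)
    (g : FreeGroup Y) :
    (lift (letterUnit p M hM) g).val.IsUpperUnitriangular := by
  have hz : ∀ (c : Y) (i j : Fin (M.length + 1)), j ≤ i → letterMatrix p M c i j = 0 := by
    intro c i j hij
    refine if_neg fun h => ?_
    have : j.val ≤ i.val := hij
    omega
  induction g using FreeGroup.induction_on with
  | C1 => simpa using Matrix.IsUpperUnitriangular.one
  | of c =>
    intro i j hij
    simp [letterUnit, hz c i j hij, Matrix.one_apply]
  | inv_of c _ =>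
    intro i j hij
    simp [letterUnit, hz c i j hij, Matrix.one_apply]
  | mul g h hg hh => simpa using hg.mul hh

/-- Each factor pushes the first row at most one column to the right, and the letter read at step
`n` is the one marked at position `n`. So the frontier entry only changes by a sign, and for the
whole word it is the corner entry. -/
theorem lift_letterUnit_take (hM : M.IsChain fun a b => a.1 ≠ b.1) (n : ℕ) (hn : n ≤ M.length) :
    (∀ j : Fin (M.length + 1), n < j.val →
      (lift (letterUnit p M hM) (mk (M.take n))).val 0 j = 0) ∧
    IsUnit ((lift (letterUnit p M hM) (mk (M.take n))).val 0 ⟨n, by omega⟩) := by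
  induction n with
  | zero =>
    refine ⟨fun j hj => ?_, ?_⟩
    · have : (0 : Fin (M.length + 1)) ≠ j := fun h => by simp [← h] at hj
      simp [← one_eq_mk, Matrix.one_apply_ne this]
    · simp [← one_eq_mk]
  | succ n ih =>
    obtain ⟨ih1, ih2⟩ := ih (by omega)
    have hlt : n < M.length := hn
    set P := (lift (letterUnit p M hM) (mk (M.take n))).val with hP
    obtain ⟨ε, hε, hstep⟩ : ∃ ε : ZMod p, IsUnit ε ∧
        (lift (letterUnit p M hM) (mk (M.take (n + 1)))).val =
          P + ε • (P * letterMatrix p M M[n].1) := by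
      have hsplit : mk (M.take (n + 1)) = mk (M.take n) * mk [M[n]] := by
        rw [mul_mk, List.take_append_getElem]
      rw [hsplit, _root_.map_mul, Units.val_mul, ← hP]
      rcases hb : M[n] with ⟨c, b⟩
      cases b
      · refine ⟨-1, isUnit_one.neg, ?_⟩
        have : (mk [(c, false)] : FreeGroup Y) = (of c)⁻¹ := rfl
        simp [this, letterUnit, mul_add, sub_eq_add_neg]
      · refine ⟨1, isUnit_one, ?_⟩
        have : (mk [(c, true)] : FreeGroup Y) = of c := rfl
        simp [this, letterUnit, mul_add]
    have hmul : ∀ j : Fin (M.length + 1), n < j.val →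
        (P * letterMatrix p M M[n].1) 0 j =
          if j.val = n + 1 then P 0 ⟨n, by omega⟩ else 0 := by
      intro j hj
      rw [Matrix.mul_apply, Finset.sum_eq_single ⟨n, by omega⟩]
      · simp [letterMatrix, List.getElem?_eq_getElem hlt]
      · intro b _ hb
        rcases lt_or_ge n b.val with h | h
        · rw [ih1 b h, zero_mul]
        · have : letterMatrix p M M[n].1 b j = 0 := by
            refine if_neg fun h' => hb (Fin.ext ?_)
            have := h'.1
            show b.val = n
            omega
          rw [this, mul_zero]
      · simp
    refine ⟨fun j hj => ?_, ?_⟩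
    · rw [hstep, Matrix.add_apply, Matrix.smul_apply, hmul j (by omega), ih1 j (by omega),
        if_neg (by omega)]
      simp
    · rw [hstep, Matrix.add_apply, Matrix.smul_apply, hmul _ (by simp), ih1 _ (by simp),
        if_pos rfl]
      simpa using hε.mul ih2

theorem lift_letterUnit_ne_one [Fact p.Prime] (hM : M.IsChain fun a b => a.1 ≠ b.1)
    (h0 : M ≠ []) : lift (letterUnit p M hM) (mk M) ≠ 1 := by
  intro h
  have h1 := (lift_letterUnit_take p M hM M.length le_rfl).2
  rw [List.take_length, h] at h1
  have : (0 : Fin (M.length + 1)) ≠ ⟨M.length, by omega⟩ := fun h => h0 (by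
    simpa [Fin.ext_iff, eq_comm] using h)
  rw [Units.val_one, Matrix.one_apply_ne this] at h1
  exact not_isUnit_zero h1

end

/-- The word obtained by substituting `(x, true) * (x, false)` for each letter `x`. -/
def doubleWord {X : Type*} : List (X × Bool) → List ((X × Bool) × Bool)
  | [] => []
  | (x, true) :: L => ((x, true), true) :: ((x, false), true) :: doubleWord L
  | (x, false) :: L => ((x, false), false) :: ((x, true), false) :: doubleWord L

theorem mk_doubleWord {X : Type*} (L : List (X × Bool)) :
    mk (doubleWord L) = lift (fun x : X => of (x, true) * of (x, false)) (mk L) := by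
  induction L with
  | nil => rfl
  | cons a L ih =>
    have hcons : ∀ {Z : Type _} (a : Z × Bool) (L : List (Z × Bool)), mk (a :: L) = mk [a] * mk L :=
      fun a L => by rw [mul_mk]; rfl
    rcases a with ⟨x, _ | _⟩
    · have h1 : (mk [(x, false)] : FreeGroup X) = (of x)⁻¹ := rfl
      have h2 : ∀ z, (mk [(z, false)] : FreeGroup (X × Bool)) = (of z)⁻¹ := fun _ => rfl
      rw [doubleWord, hcons, hcons _ (doubleWord L), hcons (x, false), _root_.map_mul, ih, h1, h2, h2]
      simp [mul_assoc]
    · have h1 : (mk [(x, true)] : FreeGroup X) = of x := rfl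
      have h2 : ∀ z, (mk [(z, true)] : FreeGroup (X × Bool)) = of z := fun _ => rfl
      rw [doubleWord, hcons, hcons _ (doubleWord L), hcons (x, true), _root_.map_mul, ih, h1, h2, h2]
      simp [mul_assoc]

/-- Doubling turns `x x` into `x₁x₂x₁x₂`; equal neighbours could only arise from `x x⁻¹` or `x⁻¹ x`.
This removes powers `x ^ n`, which the matrices `1 + N` with `N ^ 2 = 0` kill when `p ∣ n`. -/
theorem isChain_doubleWord {X : Type*} {L : List (X × Bool)} (hL : IsReduced L) :
    (doubleWord L).IsChain fun a b => a.1 ≠ b.1 := by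
  induction L with
  | nil => exact List.isChain_nil
  | cons a L ih =>
    have hL' : IsReduced L := IsReduced.infix hL ⟨[a], [], by simp⟩
    specialize ih hL'
    rcases L with _ | ⟨b, L⟩
    · rcases a with ⟨x, _ | _⟩ <;> simp [doubleWord]
    · have hab := (isReduced_cons_cons.1 hL).1
      rcases a with ⟨x, _ | _⟩ <;> rcases b with ⟨z, _ | _⟩ <;>
        simp_all [doubleWord]

/-- A nontrivial element of a free group survives in some finite `p`-group. -/
theorem exists_pGroup_hom_ne_one {X : Type*} (p : ℕ) [Fact p.Prime] (w : FreeGroup X)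
    (hw : w ≠ 1) : ∃ (Q : Type) (_ : Group Q) (_ : Finite Q) (φ : FreeGroup X →* Q),
      IsPGroup p Q ∧ φ w ≠ 1 := by
  classical
  have hM := isChain_doubleWord (isReduced_toWord (x := w))
  have h0 : doubleWord w.toWord ≠ [] := by
    have : w.toWord ≠ [] := fun h => hw (toWord_eq_nil_iff.1 h)
    rcases h : w.toWord with _ | ⟨⟨x, _ | _⟩, L⟩
    · exact absurd h this
    · simp [doubleWord]
    · simp [doubleWord]
  let ψ := lift (letterUnit p _ hM)
  refine ⟨ψ.range, inferInstance, inferInstance,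
    ψ.rangeRestrict.comp (lift fun x : X => of (x, true) * of (x, false)), ?_, ?_⟩
  · rintro ⟨_, g, rfl⟩
    obtain ⟨k, hk⟩ := (lift_letterUnit_isUpperUnitriangular p _ hM g).exists_pow_prime_pow_eq_one p
    refine ⟨k, Subtype.ext (Units.ext ?_)⟩
    simpa using hk
  · have h := lift_letterUnit_ne_one p _ hM h0
    rw [mk_doubleWord, mk_toWord] at h
    intro h'
    exact h (congrArg Subtype.val h')

/-- Finitely many nontrivial elements of a free group survive in a common finite `p`-group. -/
theorem exists_pGroup_hom_forall_ne_one {X : Type*} (p : ℕ) [Fact p.Prime]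
    (S : Set (FreeGroup X)) (hS : S.Finite) (h1 : (1 : FreeGroup X) ∉ S) :
    ∃ (Q : Type) (_ : Group Q) (_ : Finite Q) (φ : FreeGroup X →* Q),
      IsPGroup p Q ∧ ∀ w ∈ S, φ w ≠ 1 := by
  induction S, hS using Set.Finite.induction_on with
  | empty => exact ⟨Unit, inferInstance, inferInstance, 1, IsPGroup.of_card (n := 0) (by simp),
      by simp⟩
  | @insert a S _ _ ih =>
    obtain ⟨Q, _, _, φ, hQ, hφ⟩ := ih fun h => h1 (Set.mem_insert_of_mem _ h)
    obtain ⟨Q', _, _, φ', hQ', hφ'⟩ := exists_pGroup_hom_ne_one p a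
      fun h => h1 (h ▸ Set.mem_insert _ _)
    refine ⟨Q × Q', inferInstance, inferInstance, φ.prod φ', ?_, ?_⟩
    · rintro ⟨g, g'⟩
      obtain ⟨k, hk⟩ := hQ g
      obtain ⟨k', hk'⟩ := hQ' g'
      refine ⟨k + k', Prod.ext ?_ ?_⟩
      · simp [pow_add, pow_mul, hk]
      · simp [pow_add, pow_mul, mul_comm (p ^ k), hk']
    · rintro w (rfl | hw) h
      · exact hφ' (congrArg Prod.snd h)
      · exact hφ w hw (congrArg Prod.fst h)

end FreeGroup

/-! ### Fixed points on the cosets of a finitely generated subgroup -/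

namespace FreeGroup

variable {X : Type*}

theorem _root_.List.suffix_or_of_suffix_append {α : Type*} {s a b : List α} (h : s <:+ a ++ b) :
    s <:+ b ∨ ∃ t, t <:+ a ∧ t ++ b = s := by
  obtain ⟨r, hr⟩ := h
  rcases List.append_eq_append_iff.1 hr with ⟨c, hc, hc'⟩ | ⟨c, hc, hc'⟩
  · exact Or.inr ⟨c, ⟨r, hc.symm⟩, hc'.symm⟩
  · exact Or.inl ⟨c, hc'.symm⟩

/-- Words act from their right end, so suffixes are the vertices of a path. Reduction only removes
backtracking and visits no new vertex. -/
theorem Red.exists_suffix {L L' : List (X × Bool)} (h : Red L L') {s : List (X × Bool)}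
    (hs : s <:+ L') : ∃ s', s' <:+ L ∧ mk s' = mk s := by
  induction h generalizing s with
  | refl => exact ⟨s, hs, rfl⟩
  | tail _ hstep ih =>
    suffices ∃ s', s' <:+ _ ∧ mk s' = mk s by
      obtain ⟨s', hs', he⟩ := this
      obtain ⟨s'', hs'', he'⟩ := ih hs'
      exact ⟨s'', hs'', he'.trans he⟩
    cases hstep with
    | @not a c x b =>
      rcases List.suffix_or_of_suffix_append hs with h | ⟨t, ht, rfl⟩
      · exact ⟨s, h.trans ⟨a ++ [(x, b), (x, !b)], by simp⟩, rfl⟩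
      · refine ⟨t ++ (x, b) :: (x, !b) :: c, ?_, ?_⟩
        · obtain ⟨r, rfl⟩ := ht
          exact ⟨r, by simp⟩
        · exact Quot.sound Red.Step.not

/-- The cosets visited by the reduced words of the elements of a finitely generated subgroup
form a finite set. -/
theorem exists_finite_core [DecidableEq X] {H : Subgroup (FreeGroup X)} (hH : H.FG) :
    ∃ K : Set (FreeGroup X ⧸ H), K.Finite ∧
      ∀ h ∈ H, ∀ s, s <:+ h.toWord → ((mk s : FreeGroup X) : FreeGroup X ⧸ H) ∈ K := by
  obtain ⟨S, rfl⟩ := hH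
  set H := Subgroup.closure (S : Set (FreeGroup X)) with hHdef
  let K : Set (FreeGroup X ⧸ H) :=
    insert ((1 : FreeGroup X) : FreeGroup X ⧸ H)
      (⋃ g ∈ S, ⋃ s ∈ g.toWord.tails, {((mk s : FreeGroup X) : FreeGroup X ⧸ H)})
  refine ⟨K, ?_, ?_⟩
  · refine Set.Finite.insert _ (S.finite_toSet.biUnion fun g _ => ?_)
    exact (List.finite_toSet _).biUnion fun s _ => Set.finite_singleton _
  · have key : ∀ h ∈ H, ∃ L, mk L = h ∧
        ∀ s, s <:+ L → ((mk s : FreeGroup X) : FreeGroup X ⧸ H) ∈ K := by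
      intro h hh
      induction hh using Subgroup.closure_induction with
      | mem g hg =>
        refine ⟨g.toWord, mk_toWord, fun s hs => Set.mem_insert_of_mem _ ?_⟩
        simp only [Set.mem_iUnion]
        exact ⟨g, hg, s, (List.mem_tails _ _).2 hs, rfl⟩
      | one =>
        refine ⟨[], rfl, fun s hs => ?_⟩
        rw [List.suffix_nil.1 hs]
        exact Set.mem_insert _ _
      | mul g h _ hh ihg ihh =>
        obtain ⟨L, rfl, hL⟩ := ihg
        obtain ⟨L', rfl, hL'⟩ := ihh
        refine ⟨L ++ L', mul_mk.symm, fun s hs => ?_⟩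
        rcases List.suffix_or_of_suffix_append hs with h | ⟨t, ht, rfl⟩
        · exact hL' s h
        · rw [← mul_mk, QuotientGroup.mk_mul_of_mem _ hh]
          exact hL t ht
      | inv g hg ih =>
        obtain ⟨L, rfl, hL⟩ := ih
        refine ⟨invRev L, inv_mk.symm, fun s hs => ?_⟩
        obtain ⟨r, hr⟩ := hs
        have hL' : L = invRev s ++ invRev r := by
          rw [← invRev_append, hr, invRev_invRev]
        have h1 : (mk s : FreeGroup X) = mk (invRev r) * (mk L)⁻¹ := by
          rw [hL', ← mul_mk, mul_inv_rev, inv_mk, inv_mk, invRev_invRev, invRev_invRev,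
            ← mul_assoc, ← inv_mk (L := r), inv_mul_cancel, one_mul]
        rw [h1, QuotientGroup.mk_mul_of_mem _ (H.inv_mem hg)]
        exact hL _ ⟨invRev s, hL'.symm⟩
    intro h hh s hs
    obtain ⟨L, rfl, hL⟩ := key h hh
    rw [toWord_mk] at hs
    obtain ⟨s', hs', he⟩ := Red.exists_suffix reduce.red hs
    rw [← he]
    exact hL s' hs'

/-! ### Cosets fixed by a nontrivial element -/

theorem finite_setOf_norm_le [DecidableEq X] [Finite X] (N : ℕ) :
    {g : FreeGroup X | g.norm ≤ N}.Finite :=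
  Set.Finite.of_finite_image ((List.finite_length_le (X × Bool) N).subset (by
    rintro _ ⟨g, hg, rfl⟩; exact hg)) toWord_injective.injOn

theorem exists_lt_norm_pow [DecidableEq X] [Finite X] {g : FreeGroup X} (hg : g ≠ 1) (N : ℕ) :
    ∃ n : ℕ, N < (g ^ n).norm := by
  by_contra! h
  have hinj : Function.Injective fun n : ℕ => g ^ n := by
    rw [injective_pow_iff_not_isOfFinOrder]
    exact fun h => hg ((isOfFinOrder_iff_eq_one _).1 h)
  exact Set.infinite_range_of_injective hinj
    ((finite_setOf_norm_le N).subset (by rintro _ ⟨n, rfl⟩; exact h n))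

theorem mk_injOn_suffix [DecidableEq X] (g : FreeGroup X) :
    Set.InjOn (mk : List (X × Bool) → FreeGroup X) {s | s <:+ g.toWord} := by
  intro s hs t ht h
  have hr : ∀ r, r <:+ g.toWord → reduce r = r := fun r hr =>
    (IsReduced.infix isReduced_toWord hr.isInfix).reduce_eq
  rw [← hr s hs, ← hr t ht, ← toWord_mk, ← toWord_mk, h]

/-- A nontrivial element of a free group of finite rank fixes finitely many cosets of a finitely
generated subgroup. -/
theorem finite_fixedBy_quotient [DecidableEq X] [Finite X] {H : Subgroup (FreeGroup X)}
    (hH : H.FG) {w : FreeGroup X} (hw : w ≠ 1) : {u : FreeGroup X ⧸ H | w • u = u}.Finite := by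
  obtain ⟨K, hK, hcore⟩ := exists_finite_core hH
  have hfin : (⋃ s ∈ w.toWord.tails, (fun u => (mk s : FreeGroup X)⁻¹ • u) '' K).Finite :=
    (List.finite_toSet _).biUnion fun s _ => hK.image _
  refine hfin.subset fun u hu => ?_
  induction u using QuotientGroup.induction_on with | _ g =>
  have hu : w • (g : FreeGroup X ⧸ H) = g := hu
  have hpow : ∀ m : ℕ, w ^ m • (g : FreeGroup X ⧸ H) = g := fun m => by
    induction m with
    | zero => simp
    | succ m ih => rw [pow_succ, mul_smul, hu, ih]
  have hne : g⁻¹ * w * g ≠ 1 := fun h => hw (by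
    have : w = g * (g⁻¹ * w * g) * g⁻¹ := by group
    rw [this, h]; group)
  -- The reduced word of `g⁻¹ wⁿ g ∈ H` has `norm + 1` distinct suffixes, all leading into the core
  -- `K`. The stretches `g` and `g⁻¹` of the unreduced word account for at most `2 * (g.norm + 1)`
  -- of them. So a core vertex is met inside the stretch `wⁿ`; it is `r • gH` for a suffix `r` of
  -- `w`, whence `gH ∈ r⁻¹ • K`.
  obtain ⟨n, hn⟩ := exists_lt_norm_pow hne (2 * g.norm + 2)
  have hconj : (g⁻¹ * w * g) ^ n = g⁻¹ * w ^ n * g := by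
    have := conj_pow (i := n) (a := g⁻¹) (b := w)
    rw [inv_inv] at this
    exact this
  set h := (g⁻¹ * w * g) ^ n with hh
  have hmem : h ∈ H := by
    rw [hconj, mul_assoc]
    exact QuotientGroup.eq.1 (hpow n).symm
  let A : Finset (FreeGroup X) := 
    (Finset.range (h.norm + 1)).image fun i => mk (h.toWord.drop i)
  let B : Finset (FreeGroup X) := (g.toWord.tails.map mk).toFinset ∪
    ((invRev g.toWord).tails.map fun s => mk s * w ^ n * g).toFinset
  have hA : h.norm + 1 ≤ A.card := by
    rw [Finset.card_image_of_injOn, Finset.card_range]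
    intro i hi j hj hij
    have := congrArg List.length
      (mk_injOn_suffix h (List.drop_suffix i _) (List.drop_suffix j _) hij)
    have hl : h.norm = h.toWord.length := rfl
    simp only [List.length_drop, Finset.coe_range, Set.mem_Iio] at this hi hj
    omega
  have hB : B.card ≤ 2 * g.norm + 2 := by
    refine (Finset.card_union_le _ _).trans ?_
    have h1 := List.toFinset_card_le (g.toWord.tails.map (mk : _ → FreeGroup X))
    have h2 := List.toFinset_card_le
      ((invRev g.toWord).tails.map fun s => (mk s : FreeGroup X) * w ^ n * g)
    simp only [List.length_map, List.length_tails, invRev_length] at h1 h2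
    have : g.norm = g.toWord.length := rfl
    omega
  obtain ⟨a, haA, haB⟩ : ∃ a ∈ A, a ∉ B := by
    by_contra! hsub
    have := Finset.card_le_card (show A ⊆ B from hsub)
    omega
  obtain ⟨i, -, rfl⟩ := Finset.mem_image.1 haA
  have hs := List.drop_suffix i h.toWord
  set s := h.toWord.drop i
  have hsK := hcore h hmem s hs
  have hword : h = mk (invRev g.toWord ++ ((List.replicate n w.toWord).flatten ++ g.toWord)) := by
    rw [← mul_mk, ← mul_mk, ← pow_mk, ← inv_mk, mk_toWord, mk_toWord, hconj, mul_assoc]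
  rw [hword, toWord_mk] at hs
  obtain ⟨s', hs', he⟩ := Red.exists_suffix reduce.red hs
  rw [← he] at haB hsK
  simp only [B, Finset.mem_union, List.mem_toFinset, List.mem_map, List.mem_tails, not_or,
    not_exists, not_and] at haB
  rcases List.suffix_or_of_suffix_append hs' with h' | ⟨t, ht, rfl⟩
  · rcases List.suffix_or_of_suffix_append h' with h' | ⟨t, ht, rfl⟩
    · exact absurd rfl (haB.1 s' h')
    · obtain ⟨r, m, hr, htr⟩ : ∃ (r : List (X × Bool)) (m : ℕ), r <:+ w.toWord ∧
          (mk t : FreeGroup X) = mk r * w ^ m := by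
        clear * - ht
        induction n generalizing t with
        | zero =>
          refine ⟨[], 0, List.nil_suffix, ?_⟩
          have ht : t = [] := by simpa using ht
          rw [ht]
          simp [← one_eq_mk]
        | succ n ih =>
          rw [List.replicate_succ, List.flatten_cons] at ht
          rcases List.suffix_or_of_suffix_append ht with h' | ⟨r, hr, rfl⟩
          · exact ih t h'
          · exact ⟨r, n, hr, by rw [← mul_mk, ← pow_mk, mk_toWord]⟩
      simp only [Set.mem_iUnion, List.mem_tails]
      refine ⟨r, hr, _, hsK, ?_⟩
      have : ((mk (t ++ g.toWord) : FreeGroup X) : FreeGroup X ⧸ H) =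
          (mk r : FreeGroup X) • (g : FreeGroup X ⧸ H) := by
        rw [← mul_mk, htr, mk_toWord, mul_assoc]
        conv_rhs => rw [← hpow m]
        rfl
      simp only [this, inv_smul_smul]
  · refine absurd ?_ (haB.2 t ht)
    rw [← mul_mk, ← mul_mk, ← pow_mk, mk_toWord, mk_toWord, mul_assoc]

end FreeGroup

/-! ### Finite coverings approximating a partial action -/

/-- A partial injection of a finite set extends to a permutation. The arbitrary choices made here
are the new edges that later carry voltages. -/
theorem MulAction.exists_perm_extending {G α : Type*} [Group G] [MulAction G α] (V : Set α)
    [Finite V] (g : G) : ∃ σ : Equiv.Perm V, ∀ v : V, g • v.1 ∈ V → (σ v : α) = g • v.1 := by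
  classical
  have := Fintype.ofFinite V
  let e : {v : V // g • v.1 ∈ V} ≃ {v : V // g⁻¹ • v.1 ∈ V} :=
    { toFun := fun v => ⟨⟨g • v.1.1, v.2⟩, by simp⟩
      invFun := fun v => ⟨⟨g⁻¹ • v.1.1, v.2⟩, by simp⟩
      left_inv := fun v => by ext; simp
      right_inv := fun v => by ext; simp }
  refine ⟨e.extendSubtype, fun v hv => ?_⟩
  rw [Equiv.extendSubtype_apply_of_mem e v hv]
  rfl

namespace FreeGroup

variable {X : Type*}

section Voltage

variable {α : Type*} [MulAction (FreeGroup X) α] (V : Set α) (σ : X → Equiv.Perm V)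
  {A : Type*} [Group A] (θ : FreeGroup (X × V) →* A)

open Classical in
/-- The label of the edge `v ⟶ x • v`: trivial if the edge stays in `V`, and a free generator
otherwise. -/
noncomputable def voltage (x : X) (v : V) : FreeGroup (X × V) :=
  if of x • v.1 ∈ V then 1 else of (x, v)

/-- The action of a generator on the covering with voltages in `A`. -/
noncomputable def coverPerm (x : X) : Equiv.Perm (V × A) where
  toFun s := (σ x s.1, θ (voltage V x s.1) * s.2)
  invFun s := ((σ x).symm s.1, (θ (voltage V x ((σ x).symm s.1)))⁻¹ * s.2)
  left_inv s := by simp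
  right_inv s := by simp

/-- The action of the free group on the covering with voltages in `A`. -/
noncomputable def coverHom : FreeGroup X →* Equiv.Perm (V × A) :=
  lift (coverPerm V σ θ)

theorem coverHom_of (x : X) (s : V × A) :
    coverHom V σ θ (of x) s = (σ x s.1, θ (voltage V x s.1) * s.2) := by
  simp [coverHom, coverPerm]

theorem coverHom_of_inv (x : X) (s : V × A) :
    coverHom V σ θ (of x)⁻¹ s =
      ((σ x).symm s.1, (θ (voltage V x ((σ x).symm s.1)))⁻¹ * s.2) := by
  rw [_root_.map_inv, Equiv.Perm.inv_eq_iff_eq, coverHom_of]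
  simp

/-- Voltages multiply on the left, so right translations of the fiber commute with the action, and
the covering with voltages in `A` is the image under `θ` of the free one. -/
theorem coverHom_map (g : FreeGroup X) (v : V) (t : FreeGroup (X × V)) (a : A) :
    coverHom V σ θ g (v, θ t * a) =
      ((coverHom V σ (MonoidHom.id _) g (v, t)).1,
        θ (coverHom V σ (MonoidHom.id _) g (v, t)).2 * a) := by
  induction g using FreeGroup.induction_on generalizing v t with
  | C1 => simp
  | of x => simp [coverHom_of, mul_assoc]
  | inv_of x _ => simp only [coverHom_of_inv]; simp [mul_assoc]
  | mul g h hg hh => simp only [_root_.map_mul, Equiv.Perm.mul_apply, hh, hg]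

theorem coverHom_apply (g : FreeGroup X) (v : V) (a : A) :
    coverHom V σ θ g (v, a) =
      ((coverHom V σ (MonoidHom.id _) g (v, 1)).1,
        θ (coverHom V σ (MonoidHom.id _) g (v, 1)).2 * a) := by
  simpa using coverHom_map V σ θ g v 1 a

theorem mk_cons (a : X × Bool) (L : List (X × Bool)) : mk (a :: L) = mk [a] * mk L := by
  rw [mul_mk]; rfl

theorem coverHom_letter (hσ : ∀ x v, of x • v.1 ∈ V → (σ x v : α) = of x • v.1) (l : X × Bool) (v : V) (a : A)
    (h : (mk [l] : FreeGroup X) • v.1 ∈ V) :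
    coverHom V σ θ (mk [l]) (v, a) = (⟨(mk [l] : FreeGroup X) • v.1, h⟩, a) := by
  rcases l with ⟨x, _ | _⟩
  · have hl : (mk [(x, false)] : FreeGroup X) = (of x)⁻¹ := rfl
    have h' : (σ x).symm v = ⟨(mk [(x, false)] : FreeGroup X) • v.1, h⟩ := by
      rw [Equiv.symm_apply_eq]
      refine Subtype.ext ?_
      rw [hσ]
      · simp [hl]
      · simp [hl]
    simp only [hl] at h h' ⊢
    rw [coverHom_of_inv]
    simp [h', voltage]
  · have hl : (mk [(x, true)] : FreeGroup X) = of x := rfl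
    simp only [hl] at h ⊢
    rw [coverHom_of]
    refine Prod.ext (Subtype.ext (hσ x v h)) ?_
    simp [voltage, h]

/-- Along a path that stays in `V` the covering action is the original one. -/
theorem coverHom_of_forall_suffix
    (hσ : ∀ x v, of x • v.1 ∈ V → (σ x v : α) = of x • v.1) (L : List (X × Bool)) (v : V) (a : A)
    (hL : ∀ s, s <:+ L → (mk s : FreeGroup X) • v.1 ∈ V) :
    coverHom V σ θ (mk L) (v, a) = (⟨(mk L : FreeGroup X) • v.1, hL L List.suffix_rfl⟩, a) := by
  induction L with
  | nil => simp [← one_eq_mk]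
  | cons l L ih =>
    have h1 := ih fun s hs => hL s (hs.trans (List.suffix_cons _ _))
    have h2 := hL (l :: L) List.suffix_rfl
    rw [mk_cons, mul_smul] at h2
    simp only [mk_cons l L, _root_.map_mul, Equiv.Perm.mul_apply, h1, mul_smul]
    exact coverHom_letter V σ θ hσ l _ a h2

/-- The endpoint of an edge labelled by a free generator is left by the partial action. -/
theorem inv_smul_notMem_of_smul_notMem
    (hσ : ∀ x v, of x • v.1 ∈ V → (σ x v : α) = of x • v.1) {x : X} {u : V}
    (hu : of x • u.1 ∉ V) : (of x)⁻¹ • (σ x u).1 ∉ V := by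
  intro h
  have h1 : σ x ⟨_, h⟩ = σ x u := Subtype.ext (by rw [hσ] <;> simp)
  have h2 := congrArg Subtype.val ((σ x).injective h1)
  refine hu ?_
  rw [← h2]
  simp

/-- Either the path of `L` from `v` stays in `V`, or the reduced word of its voltage begins with
the label of the last edge that leaves `V`. -/
theorem coverHom_path [DecidableEq X] [DecidableEq (X × V)]
    (hσ : ∀ x v, of x • v.1 ∈ V → (σ x v : α) = of x • v.1) (R : ℕ)
    (hV : ∀ (w : FreeGroup X) (u : α), w ≠ 1 → w.norm ≤ R → w • u = u →
      ∀ x : X, of x • u ∈ V ∧ (of x)⁻¹ • u ∈ V)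
    (v : V) (L : List (X × Bool)) (hL : IsReduced L) (hR : L.length ≤ R) :
    ((coverHom V σ (MonoidHom.id _) (mk L) (v, 1)).2 = 1 ∧
      ((coverHom V σ (MonoidHom.id _) (mk L) (v, 1)).1 : α) = (mk L : FreeGroup X) • v.1) ∨
    ∃ (L₂ L₁ : List (X × Bool)) (x : X) (b : Bool) (u : V) (r : List ((X × V) × Bool)),
      L = L₂ ++ (x, b) :: L₁ ∧ of x • u.1 ∉ V ∧
      ((coverHom V σ (MonoidHom.id _) (mk L) (v, 1)).1 : α) =
        (mk L₂ : FreeGroup X) • (if b then σ x u else u).1 ∧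
      (coverHom V σ (MonoidHom.id _) (mk L) (v, 1)).2.toWord = ((x, u), b) :: r := by
  induction L with
  | nil => exact Or.inl (by simp [← one_eq_mk])
  | cons l L ih =>
    have ih := ih (IsReduced.infix hL (List.suffix_cons _ _).isInfix)
      ((List.sublist_cons_self _ _).length_le.trans hR)
    rw [mk_cons, _root_.map_mul, Equiv.Perm.mul_apply, mul_smul]
    set s := coverHom V σ (MonoidHom.id _) (mk L) (v, 1) with hs
    by_cases hold : (mk [l] : FreeGroup X) • s.1.1 ∈ V
    · rw [show s = (s.1, s.2) from rfl, coverHom_letter V σ _ hσ l _ _ hold]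
      rcases ih with ⟨h1, h2⟩ | ⟨L₂, L₁, x, b, u, r, hLL, hu, h2, hr⟩
      · exact Or.inl ⟨h1, congrArg ((mk [l] : FreeGroup X) • ·) h2⟩
      · refine Or.inr ⟨l :: L₂, L₁, x, b, u, r, by rw [hLL]; rfl, hu, ?_, hr⟩
        rw [mk_cons l L₂, mul_smul, ← h2]
    · right
      obtain ⟨z, b', c, hl, hc, hs1, hstep1, hstep2⟩ : ∃ (z : X) (b' : Bool) (c : V),
          l = (z, b') ∧ of z • c.1 ∉ V ∧ s.1 = (if b' then c else σ z c) ∧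
          (coverHom V σ (MonoidHom.id _) (mk [l]) s).1 = (if b' then σ z c else c) ∧
          (coverHom V σ (MonoidHom.id _) (mk [l]) s).2 = mk [((z, c), b')] * s.2 := by
        rcases l with ⟨z, _ | _⟩
        · have hl : (mk [(z, false)] : FreeGroup X) = (of z)⁻¹ := rfl
          rw [hl] at hold ⊢
          have hc : of z • ((σ z).symm s.1).1 ∉ V := by
            intro h
            apply hold
            have h2 := hσ z _ h
            rw [Equiv.apply_symm_apply] at h2
            rw [h2]
            simp
          refine ⟨z, false, (σ z).symm s.1, rfl, hc, by simp, ?_, ?_⟩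
          · rw [coverHom_of_inv]; rfl
          · simp only [coverHom_of_inv, voltage, if_neg hc]
            rfl
        · have hl : (mk [(z, true)] : FreeGroup X) = of z := rfl
          rw [hl] at hold ⊢
          refine ⟨z, true, s.1, rfl, hold, by simp, ?_, ?_⟩
          · simp [coverHom_of]
          · simp only [coverHom_of, voltage, if_neg hold]
            rfl
      refine ⟨[], L, z, b', c, s.2.toWord, by rw [hl]; rfl, hc, ?_, ?_⟩
      · rw [hstep1, ← one_eq_mk, one_smul]
      · rw [hstep2, toWord_mul, toWord_mk, reduce_singleton, List.singleton_append]
        rw [reduce.cons, reduce_toWord]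
        rcases ih with ⟨h1, h2⟩ | ⟨L₂, L₁, x, b, u, r, hLL, hu, h2, hr⟩
        · rw [h1, toWord_one]
        · rw [hr]
          -- Cancellation would mean that the path crosses a new edge, comes back to its endpoint
          -- along `L₂`, and crosses it backwards. As `L` is reduced, `L₂` is a short nontrivial
          -- element fixing that endpoint, and `hV` then forbids new edges there.
          refine if_neg ?_
          rintro ⟨he, hb⟩
          obtain ⟨rfl, rfl⟩ := Prod.mk.inj he
          have hb : b' = !b := hb
          have hfix : (mk L₂ : FreeGroup X) • (if b then σ z c else c).1 =
              (if b then σ z c else c).1 := by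
            rw [← h2, hs1, hb]
            cases b <;> rfl
          have hL₂ : IsReduced L₂ := IsReduced.infix hL ⟨[l], (z, b) :: L₁, by simp [hLL]⟩
          have hne : (mk L₂ : FreeGroup X) ≠ 1 := by
            intro h
            have : L₂ = [] := by
              rw [← hL₂.reduce_eq, ← toWord_mk, h, toWord_one]
            rw [this, List.nil_append] at hLL
            rw [hLL, hl, isReduced_cons_cons] at hL
            have := hL.1 rfl
            rw [hb] at this
            cases b <;> simp at this
          have hnorm : (mk L₂ : FreeGroup X).norm ≤ R := by
            refine norm_mk_le.trans (le_trans ?_ hR)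
            simp [hLL]
            omega
          have hVV := hV _ _ hne hnorm hfix z
          cases b
          · exact hc hVV.1
          · exact inv_smul_notMem_of_smul_notMem V σ hσ hc hVV.2

/-- A short word that fixes a point of the free covering already fixes the point below it. -/
theorem smul_eq_of_coverHom_eq [DecidableEq X]
    (hσ : ∀ x v, of x • v.1 ∈ V → (σ x v : α) = of x • v.1) (R : ℕ)
    (hV : ∀ (w : FreeGroup X) (u : α), w ≠ 1 → w.norm ≤ R → w • u = u →
      ∀ x : X, of x • u ∈ V ∧ (of x)⁻¹ • u ∈ V)
    (v : V) (w : FreeGroup X) (hR : w.norm ≤ R)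
    (hw : coverHom V σ (MonoidHom.id _) w (v, 1) = (v, 1)) : w • v.1 = v.1 := by
  classical
  have h := coverHom_path V σ hσ R hV v w.toWord isReduced_toWord hR
  rw [mk_toWord, hw] at h
  rcases h with ⟨-, h⟩ | ⟨_, _, _, _, _, _, _, _, _, h⟩
  · exact h.symm
  · simp at h

end Voltage

/-! ### Finite actions separating subgroups by fixed points -/

theorem norm_mk_le_of_suffix [DecidableEq X] {g : FreeGroup X} {s : List (X × Bool)}
    (hs : s <:+ g.toWord) : (mk s).norm ≤ g.norm :=
  norm_mk_le.trans hs.sublist.length_le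

/-- Given a finitely generated subgroup `H` of infinite index and finitely many finitely generated
subgroups not conjugate into `H`, there is a finite transitive action in which `H` has many fixed
points and the other subgroups have none. -/
theorem exists_finiteIndex_fixedPoints [DecidableEq X] [Finite X] {H : Subgroup (FreeGroup X)}
    (hH : H.FG) (hind : ¬ H.FiniteIndex) {ι : Type*} [Finite ι] (J : ι → Subgroup (FreeGroup X))
    (hJ : ∀ i, (J i).FG) (hn : ∀ i, ¬ (J i).IsConjInto H) (C : ℕ) :
    ∃ K : Subgroup (FreeGroup X), K.FiniteIndex ∧
      (∃ t : Fin C → FreeGroup X ⧸ K, Function.Injective t ∧ ∀ c, ∀ h ∈ H, h • t c = t c) ∧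
      ∀ i, ∀ u : FreeGroup X ⧸ K, ∃ h ∈ J i, h • u ≠ u := by
  classical
  have := Fintype.ofFinite ι
  choose S hS using hJ
  obtain ⟨S₀, hS₀⟩ := id hH
  let U : Finset (FreeGroup X) := Finset.univ.biUnion S
  let R := U.sup norm
  -- `Z` is the set of points with a short nontrivial element in their stabilizer. The radius `D`
  -- makes `V` contain all their neighbours, so that no new edge is attached to them, and also all
  -- paths of the generators of `H` from `v₀`.
  let Z : Set (FreeGroup X ⧸ H) := ⋃ w ∈ {w : FreeGroup X | w.norm ≤ R} \ {1}, {u | w • u = u}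
  have hZ : Z.Finite := ((finite_setOf_norm_le R).subset Set.sdiff_subset).biUnion
    fun w hw => finite_fixedBy_quotient hH hw.2
  let Z' : Set (FreeGroup X ⧸ H) :=
    ⋃ x : X, ((fun u => of x • u) '' Z ∪ (fun u => (of x)⁻¹ • u) '' Z)
  have hZ' : Z'.Finite := Set.finite_iUnion fun x => (hZ.image _).union (hZ.image _)
  let D := S₀.sup norm + hZ'.toFinset.sup fun u => u.out.norm
  let v₀ : FreeGroup X ⧸ H := (1 : FreeGroup X)
  let V : Set (FreeGroup X ⧸ H) := (fun g : FreeGroup X => g • v₀) '' {g | g.norm ≤ D}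
  have : Finite V := ((finite_setOf_norm_le D).image _).to_subtype
  have hsmul : ∀ g : FreeGroup X, g • v₀ = (g : FreeGroup X ⧸ H) := fun g => by
    show ((g * 1 : FreeGroup X) : FreeGroup X ⧸ H) = g
    rw [mul_one]
  have hv₀ : v₀ ∈ V := ⟨1, by simp, one_smul _ _⟩
  have hZV : Z' ⊆ V := fun u hu => by
    refine ⟨u.out, ?_, ?_⟩
    · refine le_trans ?_ (Nat.le_add_left _ _)
      exact Finset.le_sup (f := fun u : FreeGroup X ⧸ H => u.out.norm) (hZ'.mem_toFinset.2 hu)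
    · show u.out • v₀ = u
      rw [hsmul, QuotientGroup.out_eq']
  have hV : ∀ (w : FreeGroup X) (u : FreeGroup X ⧸ H), w ≠ 1 → w.norm ≤ R → w • u = u →
      ∀ x : X, of x • u ∈ V ∧ (of x)⁻¹ • u ∈ V := by
    intro w u hw hR hu x
    have huZ : u ∈ Z := Set.mem_biUnion (x := w) ⟨hR, hw⟩ hu
    exact ⟨hZV (Set.mem_iUnion.2 ⟨x, Or.inl ⟨u, huZ, rfl⟩⟩),
      hZV (Set.mem_iUnion.2 ⟨x, Or.inr ⟨u, huZ, rfl⟩⟩)⟩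
  -- Without a new edge the finite set `V` would be invariant, hence all of `F/H`, against infinite
  -- index.
  obtain ⟨x₀, u₀, hnew⟩ : ∃ (x : X) (u : V), of x • u.1 ∉ V := by
    by_contra! hall
    have hinv : ∀ g : FreeGroup X, ∀ u : V, g • u.1 ∈ V := by
      intro g
      induction g using FreeGroup.induction_on with
      | C1 => intro u; rw [one_smul]; exact u.2
      | of x => exact hall x
      | inv_of x _ =>
        intro u
        have hinj : Function.Injective fun u : V => (⟨of x • u.1, hall x u⟩ : V) :=
          fun a b hab => Subtype.ext (MulAction.injective (of x) (congrArg Subtype.val hab))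
        obtain ⟨u', hu'⟩ := Finite.surjective_of_injective hinj u
        rw [← hu', inv_smul_smul]
        exact u'.2
      | mul g h hg hh =>
        intro u
        rw [mul_smul]
        exact hg ⟨_, hh u⟩
    refine hind (Subgroup.finiteIndex_iff_finite_quotient.2 ?_)
    refine Set.finite_univ_iff.1 ((Set.toFinite V).subset fun u _ => ?_)
    induction u using QuotientGroup.induction_on with | _ g =>
    rw [← hsmul]
    exact hinv g ⟨v₀, hv₀⟩
  choose σ hσ using fun x : X => MulAction.exists_perm_extending V (of x)
  -- The voltages that must stay nontrivial in `Q`: those of the generators of the `J i`, and powers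
  -- of one new label, which will separate `C` points of the fiber over `v₀`.
  let B : Set (FreeGroup (X × V)) :=
    ((fun q : FreeGroup X × V => (coverHom V σ (MonoidHom.id _) q.1 (q.2, 1)).2) ''
      ((U : Set (FreeGroup X)) ×ˢ Set.univ) ∪ (fun c => of (x₀, u₀) ^ c) '' Set.Iio C) \ {1}
  have hB : B.Finite := Set.Finite.subset
    (((U.finite_toSet.prod Set.finite_univ).image _).union ((Set.finite_Iio C).image _))
    Set.sdiff_subset
  -- The prime is arbitrary: only finiteness of `Q` is used.
  have : Fact (Nat.Prime 2) := ⟨Nat.prime_two⟩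
  obtain ⟨Q, _, _, θ, -, hθ⟩ := exists_pGroup_hom_forall_ne_one 2 B hB fun h => h.2 rfl
  let ρ := coverHom V σ θ
  have hpath : ∀ g : FreeGroup X, g.norm ≤ D → ∀ (hg : g • v₀ ∈ V) (a : Q),
      ρ g (⟨v₀, hv₀⟩, a) = (⟨g • v₀, hg⟩, a) := by
    intro g hgD hg a
    have h := coverHom_of_forall_suffix V σ θ hσ g.toWord ⟨v₀, hv₀⟩ a fun s hs =>
      ⟨mk s, (norm_mk_le_of_suffix hs).trans hgD, rfl⟩
    simp only [mk_toWord] at h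
    exact h
  have hHfix : ∀ h ∈ H, ∀ a : Q, ρ h (⟨v₀, hv₀⟩, a) = (⟨v₀, hv₀⟩, a) := by
    intro h hh
    rw [← hS₀] at hh
    induction hh using Subgroup.closure_induction with
    | mem h hh =>
      intro a
      have hfix : h • v₀ = v₀ := by
        rw [hsmul]
        exact QuotientGroup.eq.2 (by rw [mul_one, ← hS₀]; exact inv_mem (Subgroup.subset_closure hh))
      have hD : h.norm ≤ D := (Finset.le_sup (f := norm) hh).trans (Nat.le_add_right _ _)
      rw [hpath h hD (by rw [hfix]; exact hv₀)]
      simp only [hfix]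
    | one => intro a; simp
    | mul g h _ _ hg hh => intro a; rw [_root_.map_mul, Equiv.Perm.mul_apply, hh, hg]
    | inv g _ hg => intro a; rw [_root_.map_inv, Equiv.Perm.inv_eq_iff_eq, hg]
  let K : Subgroup (FreeGroup X) :=
    (MulAction.stabilizer (Equiv.Perm (V × Q)) ((⟨v₀, hv₀⟩, 1) : V × Q)).comap ρ
  have hKmem : ∀ g, g ∈ K ↔ ρ g (⟨v₀, hv₀⟩, 1) = (⟨v₀, hv₀⟩, 1) := fun g => Iff.rfl
  have hKeq : ∀ g g' : FreeGroup X, (g : FreeGroup X ⧸ K) = g' ↔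
      ρ g (⟨v₀, hv₀⟩, 1) = ρ g' (⟨v₀, hv₀⟩, 1) := by
    intro g g'
    rw [QuotientGroup.eq, hKmem, _root_.map_mul, _root_.map_inv, Equiv.Perm.mul_apply,
      Equiv.Perm.inv_eq_iff_eq, eq_comm]
  have hker : ρ.ker ≤ K := fun g hg => by rw [hKmem, MonoidHom.mem_ker.1 hg]; rfl
  refine ⟨K, Subgroup.finiteIndex_of_le hker, ?_, ?_⟩
  · obtain ⟨g₀, hg₀, hg₀u⟩ := u₀.2
    obtain ⟨g₁, hg₁, hg₁u⟩ := (σ x₀ u₀).2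
    -- The loop at `v₀` that crosses the new edge once translates the fiber by its label, and `H`
    -- fixes that fiber pointwise.
    have hγ : ∀ a : Q, ρ (g₁⁻¹ * of x₀ * g₀) (⟨v₀, hv₀⟩, a) =
        (⟨v₀, hv₀⟩, θ (of (x₀, u₀)) * a) := by
      intro a
      have e₀ := hpath g₀ hg₀ (by rw [show g₀ • v₀ = u₀.1 from hg₀u]; exact u₀.2) a
      have e₁ := hpath g₁ hg₁ (by rw [show g₁ • v₀ = (σ x₀ u₀).1 from hg₁u]; exact (σ x₀ u₀).2)
        (θ (of (x₀, u₀)) * a)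
      rw [_root_.map_mul, _root_.map_mul, _root_.map_inv, Equiv.Perm.mul_apply,
        Equiv.Perm.mul_apply, Equiv.Perm.inv_eq_iff_eq, e₀, e₁]
      rw [show (⟨g₀ • v₀, _⟩ : V) = u₀ from Subtype.ext hg₀u]
      rw [coverHom_of, voltage, if_neg hnew]
      exact Prod.ext (Subtype.ext hg₁u.symm) rfl
    have hγc : ∀ c : ℕ, ρ ((g₁⁻¹ * of x₀ * g₀) ^ c) (⟨v₀, hv₀⟩, 1) =
        (⟨v₀, hv₀⟩, θ (of (x₀, u₀)) ^ c) := by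
      intro c
      induction c with
      | zero => simp
      | succ c ih => rw [pow_succ', _root_.map_mul, Equiv.Perm.mul_apply, ih, hγ, pow_succ']
    refine ⟨fun c => (((g₁⁻¹ * of x₀ * g₀) ^ c.val : FreeGroup X) : FreeGroup X ⧸ K), ?_, ?_⟩
    · have hlt : ∀ c c' : ℕ, c < c' → c' < C →
          θ (of (x₀, u₀)) ^ c ≠ θ (of (x₀, u₀)) ^ c' := by
        intro c c' hc hc' he
        have hmem : of (x₀, u₀) ^ (c' - c) ∈ B := by
          refine ⟨Or.inr ⟨c' - c, by simp only [Set.mem_Iio]; omega, rfl⟩, fun h => ?_⟩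
          have := congrArg norm (Set.mem_singleton_iff.1 h)
          rw [norm_of_pow, norm_one] at this
          omega
        refine hθ _ hmem ?_
        rw [_root_.map_pow]
        have : θ (of (x₀, u₀)) ^ c * θ (of (x₀, u₀)) ^ (c' - c) = θ (of (x₀, u₀)) ^ c * 1 := by
          rw [← pow_add, mul_one, he]
          congr 1
          omega
        exact mul_left_cancel this
      intro c c' hcc
      have h := (hKeq _ _).1 hcc
      rw [hγc, hγc] at h
      have h := congrArg Prod.snd h
      rcases lt_trichotomy c.val c'.val with h' | h' | h'
      · exact absurd h (hlt _ _ h' c'.2)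
      · exact Fin.ext h'
      · exact absurd h.symm (hlt _ _ h' c.2)
    · intro c h hh
      refine (hKeq (h * _) _).2 ?_
      rw [_root_.map_mul, Equiv.Perm.mul_apply, hγc, hHfix h hh]
  · intro i u
    by_contra! hu
    induction u using QuotientGroup.induction_on with | _ g =>
    obtain ⟨v, a, hva⟩ : ∃ v a, ρ g (⟨v₀, hv₀⟩, 1) = (v, a) := ⟨_, _, rfl⟩
    have hfix : ∀ h ∈ J i, ρ h (v, a) = (v, a) := by
      intro h hh
      have h1 := (hKeq (h * g) g).1 (hu h hh)
      rwa [_root_.map_mul, Equiv.Perm.mul_apply, hva] at h1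
    -- A generator fixing `(v, a)` has trivial voltage in `Q`, hence in the free group by choice of
    -- `B`, hence fixes `v` in `F/H`.
    have hgen : ∀ s ∈ S i, s • v.1 = v.1 := by
      intro s hs
      have hsJ : s ∈ J i := by rw [← hS i]; exact Subgroup.subset_closure hs
      have h1 := hfix s hsJ
      rw [coverHom_apply] at h1
      obtain ⟨h1, h2⟩ := Prod.mk.inj h1
      have hsU : s ∈ U := Finset.mem_biUnion.2 ⟨i, Finset.mem_univ _, hs⟩
      refine smul_eq_of_coverHom_eq V σ hσ R hV v s (Finset.le_sup (f := norm) hsU)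
        (Prod.ext h1 ?_)
      by_contra hne
      exact hθ _ ⟨Or.inl ⟨(s, v), ⟨hsU, Set.mem_univ _⟩, rfl⟩, hne⟩ (by simpa using h2)
    have hle : J i ≤ MulAction.stabilizer (FreeGroup X) v.1 := by
      rw [← hS i, Subgroup.closure_le]
      exact hgen
    obtain ⟨g', -, hg'⟩ := v.2
    refine hn i ⟨g'⁻¹, fun h hh => ?_⟩
    have h1 : h • v.1 = v.1 := hle hh
    rw [← show g' • v₀ = v.1 from hg', hsmul] at h1
    have h2 : ((h * g' : FreeGroup X) : FreeGroup X ⧸ H) = g' := h1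
    rw [inv_inv, mul_assoc]
    exact QuotientGroup.eq.1 h2.symm

end FreeGroup

/-! ### Permutation groups containing the alternating group -/

namespace Equiv.Perm

/-- Away from `a` each permutation fixes the support of the other, so the commutator moves only `a`,
`c a` and `d a`. -/
theorem isThreeCycle_commutator {α : Type*} [Fintype α] [DecidableEq α] {c d : Perm α} {a : α}
    (hcd : ∀ v, c v ≠ v → d v ≠ v → v = a) (hc : c a ≠ a) (hd : d a ≠ a) :
    IsThreeCycle (c * d * c⁻¹ * d⁻¹) := by
  have hca : d (c a) = c a := by
    by_contra h
    exact hc (hcd (c a) (fun h' => hc (c.injective h')) h)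
  have hda : c (d a) = d a := by
    by_contra h
    exact hd (hcd (d a) h fun h' => hd (d.injective h'))
  have hne : d a ≠ c a := fun h => hc (c.injective (by rw [← h, hda]))
  have hfixc : ∀ v, v ≠ a → d v ≠ v → c v = v := fun v hv hdv => by
    by_contra h
    exact hv (hcd v h hdv)
  have hfixd : ∀ v, v ≠ a → c v ≠ v → d v = v := fun v hv hcv => by
    by_contra h
    exact hv (hcd v hcv h)
  have key : c * d * c⁻¹ * d⁻¹ = swap a (d a) * swap a (c a) := by
    rw [mul_inv_eq_iff_eq_mul, mul_inv_eq_iff_eq_mul]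
    ext v
    simp only [mul_apply]
    by_cases hva : v = a
    · subst hva
      rw [hda, hca, swap_apply_right, swap_apply_left]
    by_cases hdv : d v = v
    · rw [hdv]
      by_cases hcva : c v = a
      · rw [hcva, swap_apply_of_ne_of_ne hd hne, swap_apply_right]
      · have hcv : c v ≠ c a := fun h => hva (c.injective h)
        by_cases hcv' : c v = v
        · rw [hcv', hdv, swap_apply_of_ne_of_ne hva (by rwa [hcv'] at hcv),
            swap_apply_of_ne_of_ne hva]
          intro h
          apply hva
          apply d.injective
          rw [hdv, h]
        · have hdcv : d (c v) = c v := hfixd _ hcva fun h => hcv' (c.injective h)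
          rw [hdcv, swap_apply_of_ne_of_ne hcva hcv, swap_apply_of_ne_of_ne hcva]
          intro h
          rw [h] at hdcv
          exact hd (d.injective hdcv)
    · have hcv := hfixc v hva hdv
      rw [hcv]
      by_cases hdva : d v = a
      · rw [hdva, swap_apply_left, swap_apply_of_ne_of_ne hc hne.symm]
      · have hddv : d (d v) ≠ d v := fun h => hdv (d.injective h)
        rw [hfixc _ hdva hddv, swap_apply_of_ne_of_ne hdva, swap_apply_of_ne_of_ne hdva]
        · exact fun h => hva (d.injective h)
        · intro h
          rw [h, hca] at hddv
          exact hddv rfl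
  rw [key]
  exact isThreeCycle_swap_mul_swap_same hd.symm hc.symm hne

/-- The powers of `ξ` are transitive, hence primitive, on the prime number of points of `B`. As `B`
is more than half of the points, primitivity passes to the whole transitive group. -/
theorem isPreprimitive_of_sumCongr_mem {A B : Type*} [Finite A] [Finite B]
    {G : Subgroup (Perm (A ⊕ B))} (hG : MulAction.IsPretransitive G (A ⊕ B)) (ξ : Perm B)
    (hξ : ∀ u v, ∃ n : ℤ, (ξ ^ n) u = v) (hmem : sumCongr 1 ξ ∈ G)
    (hp : (Nat.card B).Prime) (hlt : Nat.card A < Nat.card B) :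
    MulAction.IsPreprimitive G (A ⊕ B) := by
  have hmem' : ∀ g : Subgroup.zpowers ξ, sumCongr 1 g.1 ∈ G := by
    rintro ⟨g, n, rfl⟩
    have : sumCongr (1 : Perm A) (ξ ^ n) = sumCongr 1 ξ ^ n := by
      have := map_zpow (sumCongrHom A B) ((1, ξ) : Perm A × Perm B) n
      simpa using this
    show sumCongr (1 : Perm A) (ξ ^ n) ∈ G
    rw [this]
    exact zpow_mem hmem n
  have : MulAction.IsPretransitive (Subgroup.zpowers ξ) B := ⟨fun u v => by
    obtain ⟨n, hn⟩ := hξ u v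
    exact ⟨⟨ξ ^ n, n, rfl⟩, hn⟩⟩
  have := MulAction.IsPreprimitive.of_prime_card (G := Subgroup.zpowers ξ) hp
  let f : B →ₑ[fun g : Subgroup.zpowers ξ => (⟨sumCongr 1 g.1, hmem' g⟩ : G)] (A ⊕ B) :=
    { toFun := Sum.inr
      map_smul' := fun _ _ => rfl }
  have hr : (Set.range f).ncard = Nat.card B := by
    have hf : Function.Injective f := Sum.inr_injective
    rw [← _root_.Set.image_univ, _root_.Set.ncard_image_of_injective _ hf, _root_.Set.ncard_univ]
  refine MulAction.IsPreprimitive.of_card_lt (f := f) ?_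
  rw [hr, Nat.card_sum]
  omega

theorem exists_sumCongr_pow {A B : Type*} (α : Perm A) (ξ : Perm B) {a q : ℕ}
    (h : a.Coprime q) (hα : α ^ a = 1) (hξ : ξ ^ q = 1) :
    ∃ n : ℕ, sumCongr α ξ ^ n = sumCongr 1 ξ := by
  obtain ⟨n, hn1, hn2⟩ := Nat.chineseRemainder h 0 1
  refine ⟨n, ?_⟩
  have hs : sumCongr α ξ ^ n = sumCongr (α ^ n) (ξ ^ n) := by
    simpa using (map_pow (sumCongrHom A B) ((α, ξ) : Perm A × Perm B) n).symm
  rw [hs, pow_eq_pow_of_modEq hn1 hα, pow_eq_pow_of_modEq hn2 hξ, pow_zero, pow_one]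

/-- A full cycle on `G × ZMod n` with one point added, which agrees with the permutation
`(g, t) ↦ (a * g, t + 1)` except at `|G|` points at most. -/
theorem exists_full_cycle_option {G : Type*} [Group G] [Fintype G] (a : G) (n : ℕ) [NeZero n] :
    ∃ ξ : Perm (Option (G × ZMod n)), (∀ u v, ∃ m : ℤ, (ξ ^ m) u = v) ∧
      ξ ^ (Fintype.card G * n + 1) = 1 ∧
      {w : G × ZMod n | ξ (some w) ≠ some (a * w.1, w.2 + 1)}.ncard ≤ Fintype.card G := by
  set N := Fintype.card G * n with hN
  let idx := Fintype.equivFin G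
  -- In the numbering `κ`, the cycle is `+ 1` modulo `N + 1`. The invariant `a⁻ᵗ g` picks out one of
  -- `|G|` segments along which the translation advances by one; they are laid end to end, followed
  -- by the added point. Only the ends of segments, at `t = n - 1`, can disagree.
  let κ : Option (G × ZMod n) → ℕ := fun o =>
    o.elim N fun w => (idx (a⁻¹ ^ w.2.val * w.1)).val * n + w.2.val
  have hκsome : ∀ w : G × ZMod n, κ (some w) < N := by
    rintro ⟨g, t⟩
    have h1 : t.val < n := ZMod.val_lt t
    have h2 := (idx (a⁻¹ ^ t.val * g)).2
    show (idx (a⁻¹ ^ t.val * g)).val * n + t.val < N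
    calc _ < (idx (a⁻¹ ^ t.val * g)).val * n + n := by omega
      _ = ((idx (a⁻¹ ^ t.val * g)).val + 1) * n := by ring
      _ ≤ N := Nat.mul_le_mul_right n h2
  have hκ : Function.Injective κ := by
    rintro (_ | ⟨g, t⟩) (_ | ⟨g', t'⟩) h
    · rfl
    · exact absurd h (hκsome _).ne'
    · exact absurd h (hκsome _).ne
    · have h : (idx (a⁻¹ ^ t.val * g)).val * n + t.val =
        (idx (a⁻¹ ^ t'.val * g')).val * n + t'.val := h
      have ht : t.val = t'.val := by
        have := congrArg (· % n) h
        simpa [Nat.add_mod, Nat.mod_eq_of_lt (ZMod.val_lt t),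
          Nat.mod_eq_of_lt (ZMod.val_lt t')] using this
      rw [ht] at h
      have h3 : (idx (a⁻¹ ^ t'.val * g)).val = (idx (a⁻¹ ^ t'.val * g')).val :=
        Nat.eq_of_mul_eq_mul_right (NeZero.pos n) (by omega)
      have h4 := mul_left_cancel (idx.injective (Fin.ext h3))
      rw [h4, ZMod.val_injective n ht]
  have hκle : ∀ o, κ o < N + 1 := by
    rintro (_ | w)
    · exact Nat.lt_succ_self N
    · exact (hκsome w).trans (Nat.lt_succ_self N)
  have hbij : Function.Bijective fun o => ((κ o : ℕ) : ZMod (N + 1)) := by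
    rw [Fintype.bijective_iff_injective_and_card]
    constructor
    · intro o o' h
      have := congrArg ZMod.val h
      rw [ZMod.val_cast_of_lt (hκle o), ZMod.val_cast_of_lt (hκle o')] at this
      exact hκ this
    · simp [hN, ZMod.card]
  let e := Equiv.ofBijective _ hbij
  have hpow : ∀ (m : ℕ) o, (e.symm.permCongr (Equiv.addRight (1 : ZMod (N + 1))) ^ m) o =
      e.symm (e o + m) := by
    intro m o
    induction m with
    | zero => simp
    | succ m ih => rw [pow_succ', mul_apply, ih]; simp [Equiv.permCongr_apply, add_assoc]
  refine ⟨e.symm.permCongr (Equiv.addRight 1), ?_, ?_, ?_⟩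
  · intro u v
    refine ⟨((e v - e u).val : ℕ), ?_⟩
    rw [zpow_natCast, hpow, ZMod.natCast_zmod_val, add_sub_cancel, Equiv.symm_apply_apply]
  · ext o : 1
    rw [hpow, ZMod.natCast_self, add_zero, Equiv.symm_apply_apply, one_apply]
  · have hsub : {w : G × ZMod n | e.symm.permCongr (Equiv.addRight 1) (some w) ≠
        some (a * w.1, w.2 + 1)} ⊆ (fun g : G => (g, ((n - 1 : ℕ) : ZMod n))) '' _root_.Set.univ := by
      rintro ⟨g, t⟩ hw
      refine ⟨g, trivial, Prod.ext rfl ?_⟩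
      by_contra hne
      refine hw ?_
      have ht : t.val + 1 < n := by
        have h1 : t.val < n := ZMod.val_lt t
        rcases Nat.lt_or_ge (t.val + 1) n with h | h
        · exact h
        · refine absurd ?_ hne
          show ((n - 1 : ℕ) : ZMod n) = t
          rw [show n - 1 = t.val by omega, ZMod.natCast_zmod_val]
      have htv : (t + 1).val = t.val + 1 := by
        have h1 : 1 < n := by omega
        have : Fact (1 < n) := ⟨h1⟩
        rw [ZMod.val_add_of_lt (by rw [ZMod.val_one]; exact ht), ZMod.val_one]
      rw [Equiv.permCongr_apply, Equiv.symm_symm, Equiv.symm_apply_eq]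
      show ((κ (some (g, t)) : ℕ) : ZMod (N + 1)) + 1 = ((κ (some (a * g, t + 1)) : ℕ) : ZMod (N + 1))
      have : κ (some (a * g, t + 1)) = κ (some (g, t)) + 1 := by
        show (idx (a⁻¹ ^ (t + 1).val * (a * g))).val * n + (t + 1).val =
          (idx (a⁻¹ ^ t.val * g)).val * n + t.val + 1
        rw [htv, pow_succ, mul_assoc, inv_mul_cancel_left, add_assoc]
      rw [this]
      push_cast
      ring
    refine (Set.ncard_le_ncard hsub (Set.toFinite _)).trans ?_
    refine (Set.ncard_image_le (Set.toFinite _)).trans ?_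
    rw [_root_.Set.ncard_univ, Nat.card_eq_fintype_card]

end Equiv.Perm

/-! ### Amalgamating actions into alternating and symmetric quotients -/

open Equiv Equiv.Perm

theorem Equiv.Perm.sign_eq_one_of_odd_pow_eq_one {W : Type*} [Fintype W] [DecidableEq W]
    (ξ : Perm W) {q : ℕ} (hq : Odd q) (h : ξ ^ q = 1) : sign ξ = 1 := by
  have h1 := congrArg sign h
  rw [map_pow, Perm.sign_one] at h1
  rcases Int.units_eq_one_or (sign ξ) with h2 | h2
  · exact h2
  · rw [h2, hq.neg_one_pow] at h1
    exact absurd h1 (by decide)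

theorem Equiv.Perm.apply_none_ne_none {W : Type*} (ξ : Perm (Option W)) (w : W)
    (h : ∀ u v, ∃ n : ℤ, (ξ ^ n) u = v) : ξ none ≠ none := by
  intro h1
  obtain ⟨n, hn⟩ := h none (some w)
  rw [zpow_apply_eq_self_of_apply_eq_self h1] at hn
  exact absurd hn (by simp)

/-- `τ` swaps each `e l` with a point of `W` of its own, which ties the orbits of `E` to `W`. The
two spare points of `W` allow a transposition correcting the sign. -/
theorem Equiv.Perm.exists_connecting_perm {E W ι : Type*} [Fintype E] [Fintype W] [Fintype ι]
    [DecidableEq E] [DecidableEq W] {e : ι → E} (he : Function.Injective e)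
    (hcard : Fintype.card ι + 2 ≤ Fintype.card W) (ε : ℤˣ) :
    ∃ τ : Perm (E ⊕ W), (∀ l, ∃ w, τ (Sum.inl (e l)) = Sum.inr w) ∧
      (∀ v, τ (Sum.inl v) = Sum.inl v ∨ ∃ w, τ (Sum.inr w) = Sum.inl v) ∧
      {v | τ v ≠ v}.ncard ≤ 2 * Fintype.card ι + 2 ∧ sign τ = ε := by
  classical
  obtain ⟨k⟩ : Nonempty (ι ⊕ Bool ↪ W) :=
    Function.Embedding.nonempty_of_card_le (by simpa using hcard)
  let f : ι ⊕ ι ↪ E ⊕ W := ⟨Sum.map e fun l => k (Sum.inl l),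
    he.sumMap (k.injective.comp Sum.inl_injective)⟩
  let τ₀ : Perm (E ⊕ W) := viaFintypeEmbedding (Equiv.sumComm ι ι) f
  have hτ₀ : ∀ a, τ₀ (f a) = f (Sum.swap a) := fun a => viaFintypeEmbedding_apply_image _ _ a
  have hτ₀' : ∀ v, v ∉ Set.range f → τ₀ v = v := fun v hv =>
    viaFintypeEmbedding_apply_notMem_range _ _ hv
  let w : Bool → W := fun b => k (Sum.inr b)
  have hw : w true ≠ w false := fun h => by simpa using k.injective h
  obtain ⟨c, hc, hsign⟩ : ∃ c : Perm (E ⊕ W),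
      (c = 1 ∨ c = swap (Sum.inr (w true)) (Sum.inr (w false))) ∧ sign (τ₀ * c) = ε := by
    by_cases h : sign τ₀ = ε
    · exact ⟨1, Or.inl rfl, by simpa using h⟩
    · refine ⟨_, Or.inr rfl, ?_⟩
      rw [Perm.sign_mul, sign_swap (fun h => hw (Sum.inr_injective h))]
      rcases Int.units_eq_one_or (sign τ₀) with h1 | h1 <;>
        rcases Int.units_eq_one_or ε with h2 | h2 <;> simp_all
  have hcfix : ∀ v, v ≠ Sum.inr (w true) → v ≠ Sum.inr (w false) → c v = v := by
    intro v h1 h2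
    rcases hc with rfl | rfl
    · rfl
    · exact swap_apply_of_ne_of_ne h1 h2
  refine ⟨τ₀ * c, ?_, ?_, ?_, hsign⟩
  · intro l
    refine ⟨k (Sum.inl l), ?_⟩
    rw [mul_apply, hcfix _ Sum.inl_ne_inr Sum.inl_ne_inr]
    exact hτ₀ (Sum.inl l)
  · intro v
    by_cases hv : ∃ l, e l = v
    · obtain ⟨l, rfl⟩ := hv
      refine Or.inr ⟨k (Sum.inl l), ?_⟩
      rw [mul_apply, hcfix]
      · exact hτ₀ (Sum.inr l)
      · exact fun h => by simpa using k.injective (Sum.inr_injective h)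
      · exact fun h => by simpa using k.injective (Sum.inr_injective h)
    · refine Or.inl ?_
      rw [mul_apply, hcfix _ Sum.inl_ne_inr Sum.inl_ne_inr]
      refine hτ₀' _ ?_
      rintro ⟨l | l, hl⟩
      · exact hv ⟨l, Sum.inl_injective hl⟩
      · exact absurd hl Sum.inr_ne_inl
  · have hsub : {v | (τ₀ * c) v ≠ v} ⊆
        Set.range f ∪ {Sum.inr (w true), Sum.inr (w false)} := by
      intro v hv
      by_contra hv'
      simp only [Set.mem_union, Set.mem_insert_iff, Set.mem_singleton_iff, not_or] at hv'
      apply hv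
      rw [mul_apply, hcfix v hv'.2.1 hv'.2.2, hτ₀' v hv'.1]
    refine (Set.ncard_le_ncard hsub (Set.toFinite _)).trans ((Set.ncard_union_le _ _).trans ?_)
    refine Nat.add_le_add ?_ (Set.ncard_insert_le _ _ |>.trans (by simp))
    rw [← Set.image_univ]
    refine (Set.ncard_image_le (Set.toFinite _)).trans ?_
    simp [two_mul]

/-- The action on a disjoint union of three sets and a fixed point. -/
def blockHom {F E W₁ W₂ : Type*} [Group F] (ρ : F →* Perm E) (ρ₁ : F →* Perm W₁)
    (ρ₂ : F →* Perm W₂) : F →* Perm ((E ⊕ W₁) ⊕ Option W₂) where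
  toFun g := Perm.sumCongr (Perm.sumCongr (ρ g) (ρ₁ g)) (optionCongr (ρ₂ g))
  map_one' := by ext ((v | v) | (_ | v)) <;> simp
  map_mul' g h := by ext ((v | v) | (_ | v)) <;> simp

/-- Exchange of the second and third sets in the disjoint union of three sets and a point. -/
def blockSwap (E W₁ W₂ : Type*) : (E ⊕ W₂) ⊕ Option W₁ ≃ (E ⊕ W₁) ⊕ Option W₂ where
  toFun
    | Sum.inl (Sum.inl v) => Sum.inl (Sum.inl v)
    | Sum.inl (Sum.inr v) => Sum.inr (some v)
    | Sum.inr none => Sum.inr none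
    | Sum.inr (some v) => Sum.inl (Sum.inr v)
  invFun
    | Sum.inl (Sum.inl v) => Sum.inl (Sum.inl v)
    | Sum.inl (Sum.inr v) => Sum.inr (some v)
    | Sum.inr none => Sum.inr none
    | Sum.inr (some v) => Sum.inl (Sum.inr v)
  left_inv := by rintro ((v | v) | (_ | v)) <;> rfl
  right_inv := by rintro ((v | v) | (_ | v)) <;> rfl

theorem FreeGroup.map_mem_of_forall_of {X β : Type*} [Finite β] (ρ : FreeGroup X →* Perm β)
    {A : Set β} (hA : ∀ x, ∀ v ∈ A, ρ (of x) v ∈ A) (g : FreeGroup X) {v : β} (hv : v ∈ A) :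
    ρ g v ∈ A := by
  induction g using FreeGroup.induction_on generalizing v with
  | C1 => simpa using hv
  | of x => exact hA x v hv
  | inv_of x _ =>
    have hinj : Function.Injective fun u : A => (⟨ρ (of x) u.1, hA x u.1 u.2⟩ : A) :=
      fun a b hab => Subtype.ext ((ρ (of x)).injective (congrArg Subtype.val hab))
    obtain ⟨u, hu⟩ := Finite.surjective_of_injective hinj ⟨v, hv⟩
    have hu : ρ (of x) u.1 = v := congrArg Subtype.val hu
    rw [_root_.map_inv, ← hu, ← mul_apply, inv_mul_cancel, one_apply]
    exact u.2
  | mul g h hg hh =>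
    rw [_root_.map_mul, Equiv.Perm.mul_apply]
    exact hg (hh hv)

/-- An action on `E` with finitely many orbits and two actions that are almost long cycles combine,
after boundedly many changes, into a surjection onto an alternating or symmetric group. -/
theorem exists_amalgam {X E W₁ W₂ ι : Type*} [DecidableEq X] [Fintype E] [Fintype W₁] [Fintype W₂]
    [Fintype ι] [DecidableEq E] [DecidableEq W₁] [DecidableEq W₂]
    (ρ : FreeGroup X →* Perm E) (ρ₁ : FreeGroup X →* Perm W₁) (ρ₂ : FreeGroup X →* Perm W₂)
    {x y : X} (hxy : x ≠ y) {e : ι → E} (he : Function.Injective e)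
    (hcov : ∀ v, ∃ l g, ρ g (e l) = v) (ξ₁ : Perm (Option W₁)) (ξ₂ : Perm (Option W₂))
    (hξ₁ : ∀ u v, ∃ n : ℤ, (ξ₁ ^ n) u = v) (hξ₂ : ∀ u v, ∃ n : ℤ, (ξ₂ ^ n) u = v)
    (hq₁ : ξ₁ ^ (Fintype.card W₁ + 1) = 1) (hq₂ : ξ₂ ^ (Fintype.card W₂ + 1) = 1)
    (hodd₁ : Odd (Fintype.card W₁ + 1)) (hodd₂ : Odd (Fintype.card W₂ + 1))
    (hprime : (Fintype.card W₂ + 1).Prime) {a : ℕ} (ha : a.Coprime (Fintype.card W₁ + 1))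
    (haE : ρ (.of x) ^ a = 1) (ha₂ : ρ₂ (.of x) ^ a = 1)
    (hcard : Fintype.card E + Fintype.card W₁ < Fintype.card W₂ + 1)
    (hcard' : Fintype.card ι + 2 ≤ Fintype.card W₁)
    (hs : ∀ z, sign (ρ (.of z)) = 1) (hs₁ : ∀ z, z ≠ x → sign (ρ₁ (.of z)) = 1)
    (hs₂ : ∀ z, z ≠ y → sign (ρ₂ (.of z)) = 1) {d : ℕ}
    (hd₁ : {w | ξ₁ (some w) ≠ some (ρ₁ (.of x) w)}.ncard ≤ d)
    (hd₂ : {w | ξ₂ (some w) ≠ some (ρ₂ (.of y) w)}.ncard ≤ d) (ε : ℤˣ) :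
    ∃ ρ' : FreeGroup X →* Perm ((E ⊕ W₁) ⊕ Option W₂),
      (ε = 1 → ρ'.range = alternatingGroup _) ∧ (ε = -1 → ρ'.range = ⊤) ∧
      ∀ z, {v | blockHom ρ ρ₁ ρ₂ (.of z) v ≠ ρ' (.of z) v}.ncard ≤
        d + 2 * Fintype.card ι + 3 := by
  obtain ⟨τ, hτ₁, hτ₂, hτ₃, hτ₄⟩ := exists_connecting_perm he hcard' ε
  let s := blockSwap E W₁ W₂
  let α : Perm (E ⊕ W₂) := Perm.sumCongr (ρ (.of x)) (ρ₂ (.of x))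
  let β : Perm (E ⊕ W₁) := Perm.sumCongr (ρ (.of y)) (ρ₁ (.of y)) * τ
  -- Both cycles pass through the extra point: `x'` runs `ξ₁` on it and `W₁`, while `y'` runs `ξ₂`
  -- on it and `W₂`. They have no other common point.
  let x' : Perm ((E ⊕ W₁) ⊕ Option W₂) := s.permCongr (Perm.sumCongr α ξ₁)
  let y' : Perm ((E ⊕ W₁) ⊕ Option W₂) := Perm.sumCongr β ξ₂
  let ρ' : FreeGroup X →* Perm ((E ⊕ W₁) ⊕ Option W₂) := FreeGroup.lift fun z =>
    if z = x then x' else if z = y then y' else blockHom ρ ρ₁ ρ₂ (.of z)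
  have hx' : ρ' (.of x) = x' := by simp [ρ']
  have hy' : ρ' (.of y) = y' := by simp [ρ', hxy.symm]
  have hz' : ∀ z, z ≠ x → z ≠ y → ρ' (.of z) = blockHom ρ ρ₁ ρ₂ (.of z) := fun z h1 h2 => by
    simp [ρ', h1, h2]
  have hsx : sign x' = 1 := by
    rw [sign_permCongr, sign_sumCongr, sign_sumCongr, hs, hs₂ x hxy, sign_eq_one_of_odd_pow_eq_one ξ₁ hodd₁ hq₁]
    simp
  have hsy : sign y' = ε := by
    rw [sign_sumCongr, Perm.sign_mul, sign_sumCongr, hs, hs₁ y hxy.symm, sign_eq_one_of_odd_pow_eq_one ξ₂ hodd₂ hq₂, hτ₄]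
    simp
  have hsz : ∀ z, z ≠ x → z ≠ y → sign (ρ' (.of z)) = 1 := by
    intro z h1 h2
    rw [hz' z h1 h2]
    show sign (Perm.sumCongr (Perm.sumCongr (ρ (.of z)) (ρ₁ (.of z))) (optionCongr (ρ₂ (.of z)))) = 1
    rw [sign_sumCongr, sign_sumCongr, hs, hs₁ z h1, optionCongr_sign, hs₂ z h2]
    simp
  -- powers of `x'` and `y'` act as cycles
  obtain ⟨n₁, hn₁⟩ : ∃ n : ℕ, x' ^ n = s.permCongr (Perm.sumCongr 1 ξ₁) := by
    have hα : α ^ a = 1 := by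
      have := map_pow (sumCongrHom E W₂) ((ρ (.of x), ρ₂ (.of x)) : Perm E × Perm W₂) a
      rw [Prod.pow_mk, haE, ha₂] at this
      simpa using this.symm
    obtain ⟨n, hn⟩ := exists_sumCongr_pow α ξ₁ ha hα hq₁
    refine ⟨n, ?_⟩
    have := map_pow s.permCongrHom (Perm.sumCongr α ξ₁) n
    rw [hn] at this
    exact this.symm
  obtain ⟨n₂, hn₂⟩ : ∃ n : ℕ, y' ^ n = Perm.sumCongr 1 ξ₂ := by
    -- The order of `β` divides `|E ⊕ W₁|!`, which is prime to the larger prime `|W₂| + 1`.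
    refine exists_sumCongr_pow β ξ₂ (a := Fintype.card (Perm (E ⊕ W₁))) ?_ pow_card_eq_one hq₂
    rw [Fintype.card_perm, Nat.coprime_comm, Nat.coprime_factorial_iff hprime.ne_one,
      hprime.minFac_eq]
    simpa using hcard
  have hc : s.permCongr (Perm.sumCongr 1 ξ₁) ∈ ρ'.range := by
    rw [← hn₁, ← hx', ← map_pow]; exact ⟨_, rfl⟩
  have hd : Perm.sumCongr 1 ξ₂ ∈ ρ'.range := by
    rw [← hn₂, ← hy', ← map_pow]; exact ⟨_, rfl⟩
  -- transitivity
  let star : (E ⊕ W₁) ⊕ Option W₂ := Sum.inr none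
  let O : Set ((E ⊕ W₁) ⊕ Option W₂) := {v | ∃ g, ρ' g star = v}
  have hOmul : ∀ g v, v ∈ O → ρ' g v ∈ O := by
    rintro g v ⟨h, rfl⟩
    exact ⟨g * h, by rw [map_mul, mul_apply]⟩
  have hOinv : ∀ g v, ρ' g v ∈ O → v ∈ O := fun g v h => by
    have := hOmul g⁻¹ _ h
    rwa [map_inv, ← mul_apply, inv_mul_cancel, one_apply] at this
  have hO₂ : ∀ u, Sum.inr u ∈ O := by
    intro u
    obtain ⟨n, hn⟩ := hξ₂ none u
    have hmem := zpow_mem hd n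
    obtain ⟨g, hg⟩ := hmem
    refine ⟨g, ?_⟩
    rw [hg]
    have := map_zpow (sumCongrHom (E ⊕ W₁) (Option W₂)) ((1, ξ₂) : Perm (E ⊕ W₁) × Perm (Option W₂)) n
    have h2 : (Perm.sumCongr (1 : Perm (E ⊕ W₁)) ξ₂) ^ n = Perm.sumCongr (1 ^ n) (ξ₂ ^ n) := this.symm
    rw [h2]
    show Sum.inr ((ξ₂ ^ n) none) = _
    rw [hn]
  have hO₁ : ∀ u : Option W₁, s (Sum.inr u) ∈ O := by
    intro u
    obtain ⟨n, hn⟩ := hξ₁ none u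
    obtain ⟨g, hg⟩ := zpow_mem hc n
    refine ⟨g, ?_⟩
    rw [hg]
    have h1 := map_zpow (sumCongrHom (E ⊕ W₂) (Option W₁)) ((1, ξ₁) : Perm (E ⊕ W₂) × Perm (Option W₁)) n
    have h2 : (Perm.sumCongr (1 : Perm (E ⊕ W₂)) ξ₁) ^ n = Perm.sumCongr (1 ^ n) (ξ₁ ^ n) := h1.symm
    have h3 := map_zpow s.permCongrHom (Perm.sumCongr (1 : Perm (E ⊕ W₂)) ξ₁) n
    have h4 : (s.permCongr (Perm.sumCongr (1 : Perm (E ⊕ W₂)) ξ₁)) ^ n =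
      s.permCongr ((Perm.sumCongr (1 : Perm (E ⊕ W₂)) ξ₁) ^ n) := h3.symm
    rw [h4, h2, Equiv.permCongr_apply]
    show s (Sum.inr ((ξ₁ ^ n) none)) = _
    rw [hn]
  have hO₁' : ∀ w : W₁, Sum.inl (Sum.inr w) ∈ O := fun w => hO₁ (some w)
  have hOE : ∀ v : E, Sum.inl (Sum.inl v) ∈ O := by
    have hstep : ∀ z, ∀ v ∈ {v : E | (Sum.inl (Sum.inl v) : (E ⊕ W₁) ⊕ Option W₂) ∈ O},
        ρ (.of z) v ∈ {v : E | (Sum.inl (Sum.inl v) : (E ⊕ W₁) ⊕ Option W₂) ∈ O} := by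
      intro z v hv
      show Sum.inl (Sum.inl (ρ (.of z) v)) ∈ O
      by_cases h1 : z = x
      · subst h1
        have := hOmul (.of z) _ hv
        rw [hx'] at this
        exact this
      by_cases h2 : z = y
      · subst h2
        have hβ : ∀ u, τ u = Sum.inl v → y' (Sum.inl u) = Sum.inl (Sum.inl (ρ (.of z) v)) := by
          intro u hu
          show Sum.inl (Perm.sumCongr (ρ (.of z)) (ρ₁ (.of z)) (τ u)) = _
          rw [hu]
          rfl
        -- Where `τ` breaks the old edge of `y` at `v`, its endpoint is still reached, from the
        -- point of `W₁` that `τ` sends to `v`.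
        rcases hτ₂ v with h | ⟨w, hw⟩
        · rw [← hβ _ h, ← hy']
          exact hOmul _ _ hv
        · rw [← hβ _ hw, ← hy']
          exact hOmul _ _ (hO₁' w)
      · have := hOmul (.of z) _ hv
        rw [hz' z h1 h2] at this
        exact this
    intro v
    obtain ⟨l, g, rfl⟩ := hcov v
    refine FreeGroup.map_mem_of_forall_of ρ hstep g ?_
    obtain ⟨w, hw⟩ := hτ₁ l
    refine hOinv (.of y) _ ?_
    rw [hy']
    have : y' (Sum.inl (Sum.inl (e l))) = Sum.inl (Sum.inr (ρ₁ (.of y) w)) := by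
      show Sum.inl (Perm.sumCongr (ρ (.of y)) (ρ₁ (.of y)) (τ (Sum.inl (e l)))) = _
      rw [hw]
      rfl
    rw [this]
    exact hO₁' _
  have htrans : MulAction.IsPretransitive ρ'.range ((E ⊕ W₁) ⊕ Option W₂) := by
    have hall : ∀ v, v ∈ O := by
      rintro ((v | v) | v)
      · exact hOE v
      · exact hO₁' v
      · exact hO₂ v
    refine ⟨fun u v => ?_⟩
    obtain ⟨g, hg⟩ := hall u
    obtain ⟨h, hh⟩ := hall v
    refine ⟨⟨ρ' (h * g⁻¹), _, rfl⟩, ?_⟩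
    show ρ' (h * g⁻¹) u = v
    rw [map_mul, map_inv, ← hg, ← mul_apply, inv_mul_cancel_right, hh]
  have hprim := isPreprimitive_of_sumCongr_mem htrans ξ₂ hξ₂ hd (by simpa using hprime)
    (by simpa using hcard)
  have h3 := isThreeCycle_commutator (c := s.permCongr (Perm.sumCongr 1 ξ₁)) (d := Perm.sumCongr 1 ξ₂)
    (a := star) (by
      rintro ((v | v) | (_ | v)) h1 h2
      · exact absurd rfl h2
      · exact absurd rfl h2
      · rfl
      · exact absurd rfl h1) (by
      obtain ⟨w⟩ : Nonempty W₁ := Fintype.card_pos_iff.1 (by omega)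
      intro h
      have h : s (Sum.inr (ξ₁ none)) = s (Sum.inr none) := h
      exact apply_none_ne_none ξ₁ w hξ₁ (Sum.inr_injective (s.injective h))) (by
      obtain ⟨w⟩ : Nonempty W₂ := Fintype.card_pos_iff.1 (by omega)
      intro h
      exact apply_none_ne_none ξ₂ w hξ₂ (Sum.inr_injective h))
  have halt : alternatingGroup _ ≤ ρ'.range :=
    alternatingGroup_le_of_isPreprimitive_of_isThreeCycle_mem hprim h3
      (mul_mem (mul_mem (mul_mem hc hd) (inv_mem hc)) (inv_mem hd))
  refine ⟨ρ', ?_, ?_, ?_⟩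
  · rintro rfl
    refine le_antisymm (FreeGroup.range_lift_le ?_) halt
    rintro _ ⟨z, rfl⟩
    show _ ∈ alternatingGroup _
    rw [mem_alternatingGroup]
    have hz : sign (ρ' (.of z)) = 1 := by
      by_cases h1 : z = x
      · rw [h1, hx', hsx]
      by_cases h2 : z = y
      · rw [h2, hy', hsy]
      exact hsz z h1 h2
    simpa only [ρ', FreeGroup.lift_apply_of] using hz
  · rintro rfl
    refine eq_top_iff.2 fun g _ => ?_
    rcases Int.units_eq_one_or (sign g) with h | h
    · exact halt (mem_alternatingGroup.2 h)
    · have h1 : g * y' ∈ ρ'.range := halt (mem_alternatingGroup.2 (by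
        rw [Perm.sign_mul, h, hsy]; rfl))
      have h2 : y' ∈ ρ'.range := hy' ▸ ⟨_, rfl⟩
      simpa using mul_mem h1 (inv_mem h2)
  · intro z
    have hxb : {v | blockHom ρ ρ₁ ρ₂ (.of x) v ≠ ρ' (.of x) v} ⊆
        insert star ((fun w => Sum.inl (Sum.inr w)) ''
          {w | ξ₁ (some w) ≠ some (ρ₁ (.of x) w)}) := by
      rintro ((v | v) | (_ | v)) hv
      · exact absurd (by rw [hx']; rfl) hv
      · refine Or.inr ⟨v, fun h => hv ?_, rfl⟩
        rw [hx']
        show Sum.inl (Sum.inr (ρ₁ (.of x) v)) = s (Sum.inr (ξ₁ (some v)))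
        rw [h]
        rfl
      · exact Or.inl rfl
      · exact absurd (by rw [hx']; rfl) hv
    have hyb : {v | blockHom ρ ρ₁ ρ₂ (.of y) v ≠ ρ' (.of y) v} ⊆
        insert star ((fun w => Sum.inr (some w)) '' {w | ξ₂ (some w) ≠ some (ρ₂ (.of y) w)}) ∪
          Sum.inl '' {v | τ v ≠ v} := by
      rintro (v | (_ | v)) hv
      · refine Or.inr ⟨v, fun h => hv ?_, rfl⟩
        rw [hy']
        show Sum.inl (Perm.sumCongr (ρ (.of y)) (ρ₁ (.of y)) v) =
          Sum.inl (Perm.sumCongr (ρ (.of y)) (ρ₁ (.of y)) (τ v))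
        rw [h]
      · exact Or.inl (Or.inl rfl)
      · refine Or.inl (Or.inr ⟨v, fun h => hv ?_, rfl⟩)
        rw [hy']
        show Sum.inr (some (ρ₂ (.of y) v)) = Sum.inr (ξ₂ (some v))
        rw [h]
    by_cases h1 : z = x
    · rw [h1]
      refine (Set.ncard_le_ncard hxb (Set.toFinite _)).trans ((Set.ncard_insert_le _ _).trans ?_)
      have := Set.ncard_image_le (f := fun w => (Sum.inl (Sum.inr w) : (E ⊕ W₁) ⊕ Option W₂))
        (Set.toFinite {w | ξ₁ (some w) ≠ some (ρ₁ (.of x) w)})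
      omega
    by_cases h2 : z = y
    · rw [h2]
      refine (Set.ncard_le_ncard hyb (Set.toFinite _)).trans ((Set.ncard_union_le _ _).trans ?_)
      have h3 := Set.ncard_insert_le star
        ((fun w => Sum.inr (some w)) '' {w | ξ₂ (some w) ≠ some (ρ₂ (.of y) w)})
      have h4 := Set.ncard_image_le (f := fun w => (Sum.inr (some w) : (E ⊕ W₁) ⊕ Option W₂))
        (Set.toFinite {w | ξ₂ (some w) ≠ some (ρ₂ (.of y) w)})
      have h5 := Set.ncard_image_le (f := (Sum.inl : E ⊕ W₁ → (E ⊕ W₁) ⊕ Option W₂))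
        (Set.toFinite {v | τ v ≠ v})
      omega
    · rw [hz' z h1 h2]
      simp

/-! ### Points on which a subgroup acts through a `p`-group -/

/-- The subgroup `H` acts on the orbit of `v` through a `p`-group. -/
def IsPrimePowerPoint {F Ω : Type*} [Group F] (ρ : F →* Perm Ω) (H : Subgroup F) (p : ℕ)
    (v : Ω) : Prop :=
  ∀ h ∈ H, ∃ k : ℕ, ρ (h ^ p ^ k) v = v

/-- Each letter of `h` is charged with at most `D` points. It matters that `c` does not depend on
`Ω`: it fixes the number of orbits to be asked of an action not yet built. -/
theorem FreeGroup.exists_discrepancy_bound {X : Type*} (h : FreeGroup X) :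
    ∃ c : ℕ, ∀ {Ω : Type} [Finite Ω] (ρ ρ' : FreeGroup X →* Perm Ω) (D : ℕ),
      (∀ z, {v | ρ (of z) v ≠ ρ' (of z) v}.ncard ≤ D) → {v | ρ h v ≠ ρ' h v}.ncard ≤ c * D := by
  induction h using FreeGroup.induction_on with
  | C1 => exact ⟨0, fun ρ ρ' D _ => by simp⟩
  | of z => exact ⟨1, fun ρ ρ' D h => by simpa using h z⟩
  | inv_of z _ =>
    refine ⟨1, fun ρ ρ' D h => ?_⟩
    rw [one_mul]
    refine le_trans ?_ (h z)
    refine Set.ncard_le_ncard_of_injOn (ρ (of z)⁻¹) (fun v hv hv' => hv ?_)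
      (ρ _).injective.injOn (Set.toFinite _)
    rw [← mul_apply, ← _root_.map_mul, mul_inv_cancel, _root_.map_one, one_apply] at hv'
    conv_rhs => rw [hv', ← mul_apply, ← _root_.map_mul, inv_mul_cancel, _root_.map_one, one_apply]
  | mul g h hg hh =>
    obtain ⟨c, hc⟩ := hg
    obtain ⟨c', hc'⟩ := hh
    refine ⟨c' + c, fun {Ω} _ ρ ρ' D hD => ?_⟩
    have hsub : {v | ρ (g * h) v ≠ ρ' (g * h) v} ⊆
        {v | ρ h v ≠ ρ' h v} ∪ {v | ρ g (ρ h v) ≠ ρ' g (ρ h v)} := by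
      intro v hv
      by_contra hv'
      simp only [Set.mem_union, Set.mem_setOf_eq, not_or, not_not] at hv'
      apply hv
      rw [_root_.map_mul, _root_.map_mul, mul_apply, mul_apply, hv'.2, ← hv'.1]
    refine (Set.ncard_le_ncard hsub (Set.toFinite _)).trans ((Set.ncard_union_le _ _).trans ?_)
    rw [add_mul]
    refine Nat.add_le_add (hc' ρ ρ' D hD) (le_trans ?_ (hc ρ ρ' D hD))
    exact Set.ncard_le_ncard_of_injOn (ρ h) (fun v hv => hv) (ρ h).injective.injOn (Set.toFinite _)

theorem map_apply_eq_of_orbit_avoids {F Ω : Type*} [Group F] {ρ ρ' : F →* Perm Ω}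
    {H : Subgroup F} {S : Set F} (hS : Subgroup.closure S = H) {v : Ω}
    (hv : ∀ h ∈ H, ∀ s ∈ S, ρ s (ρ' h v) = ρ' s (ρ' h v)) {h : F} (hh : h ∈ H) :
    ρ h v = ρ' h v := by
  suffices ∀ h ∈ Subgroup.closure S, ∀ g ∈ H, ρ h (ρ' g v) = ρ' h (ρ' g v) by
    simpa using this h (hS ▸ hh) 1 H.one_mem
  intro h hh
  induction hh using Subgroup.closure_induction with
  | mem s hs => exact fun g hg => hv g hg s hs
  | one => simp
  | mul a b _ hb iha ihb =>
    intro g hg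
    have := iha (b * g) (H.mul_mem (hS ▸ hb) hg)
    rw [map_mul ρ' b, mul_apply] at this
    rw [map_mul, map_mul, mul_apply, mul_apply, ihb g hg, this]
  | inv a ha iha =>
    intro g hg
    have := iha (a⁻¹ * g) (H.mul_mem (H.inv_mem (hS ▸ ha)) hg)
    have he : ρ' a (ρ' (a⁻¹ * g) v) = ρ' g v := by
      rw [← mul_apply, ← map_mul, mul_inv_cancel_left]
    have he' : ρ' a⁻¹ (ρ' g v) = ρ' (a⁻¹ * g) v := by rw [map_mul, mul_apply]
    rw [he', map_inv ρ, inv_eq_iff_eq, this, he]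

/-- If `K` has many orbits of `p`-power points while `H` has almost none, then a small perturbation
of the action does not make `H` conjugate into `K`. -/
theorem not_conj_of_primePowerPoints {F Ω : Type*} [Group F] [Finite Ω] (ρ ρ' : F →* Perm Ω)
    {H K : Subgroup F} {S R : Set F} (hS : Subgroup.closure S = H) (hR : Subgroup.closure R = K)
    {p : ℕ} {Z : Set Ω} (hZ : ∀ v, v ∉ Z → ¬ IsPrimePowerPoint ρ H p v) {C : ℕ} (T : Fin C → Ω)
    (hT : ∀ c, IsPrimePowerPoint ρ K p (T c))
    (hT' : ∀ c c', ∀ h ∈ K, ρ h (T c) = T c' → c = c')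
    (hC : {v | ∃ s ∈ S, ρ s v ≠ ρ' s v}.ncard + Z.ncard + {v | ∃ s ∈ R, ρ s v ≠ ρ' s v}.ncard < C)
    (g : Perm Ω) (hg : ∀ h ∈ H, ∃ h' ∈ K, g * ρ' h * g⁻¹ = ρ' h') : False := by
  set A := {v | ∃ s ∈ S, ρ s v ≠ ρ' s v}
  set B := {v | ∃ s ∈ R, ρ s v ≠ ρ' s v}
  -- Each `T c` is charged to a bad point in its `K`-orbit or in the `H`-orbit of `g⁻¹ (T c)`. If
  -- there were none, the two actions would agree on both orbits and conjugation by `g` would make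
  -- `g⁻¹ (T c)` a `p`-power point of `H`, against `hZ`. Distinct orbits are charged to distinct
  -- points.
  have hdich : ∀ c, ∃ b : Ω ⊕ Ω, b ∈ Sum.inl '' (A ∪ Z) ∪ Sum.inr '' B ∧
      ((∃ h ∈ K, b = Sum.inr (ρ h (T c))) ∨
        (∃ h ∈ H, b = Sum.inl (ρ' h (g⁻¹ (T c)))) ∧ ∀ h ∈ K, ρ h (T c) = ρ' h (T c)) := by
    intro c
    by_cases hB : ∃ h ∈ K, ρ h (T c) ∈ B
    · obtain ⟨h, hh, hb⟩ := hB
      exact ⟨_, Or.inr ⟨_, hb, rfl⟩, Or.inl ⟨h, hh, rfl⟩⟩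
    have hgood : ∀ h ∈ K, ρ h (T c) = ρ' h (T c) := fun h hh =>
      (map_apply_eq_of_orbit_avoids hR (ρ := ρ') (ρ' := ρ) (fun h hh s hs => by
        by_contra hne
        exact hB ⟨h, hh, s, hs, fun h' => hne h'.symm⟩) hh).symm
    by_cases hA : ∃ h ∈ H, ρ' h (g⁻¹ (T c)) ∈ A ∪ Z
    · obtain ⟨h, hh, hb⟩ := hA
      exact ⟨_, Or.inl ⟨_, hb, rfl⟩, Or.inr ⟨⟨h, hh, rfl⟩, hgood⟩⟩
    exfalso
    have heq : ∀ h ∈ H, ρ h (g⁻¹ (T c)) = ρ' h (g⁻¹ (T c)) := fun h hh =>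
      map_apply_eq_of_orbit_avoids hS (fun h hh s hs => by
        by_contra hne
        exact hA ⟨h, hh, Or.inl ⟨s, hs, hne⟩⟩) hh
    refine hZ (g⁻¹ (T c)) (fun h => hA ⟨1, H.one_mem, Or.inr (by simpa using h)⟩) ?_
    intro h hh
    obtain ⟨h', hh', he⟩ := hg h hh
    obtain ⟨k, hk⟩ := hT c h' hh'
    refine ⟨k, ?_⟩
    rw [hgood _ (K.pow_mem hh' _), map_pow, ← he, conj_pow, ← map_pow, mul_apply, mul_apply] at hk
    rw [heq _ (H.pow_mem hh _), eq_comm, inv_eq_iff_eq, hk]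
  choose b hb hb' using hdich
  have hinj : Function.Injective b := by
    intro c c' hcc
    rcases hb' c with ⟨h, hh, he⟩ | ⟨⟨h, hh, he⟩, hgood⟩ <;>
      rcases hb' c' with ⟨h', hh', he'⟩ | ⟨⟨h', hh', he'⟩, -⟩ <;> rw [he, he'] at hcc
    · refine hT' c c' (h'⁻¹ * h) (K.mul_mem (K.inv_mem hh') hh) ?_
      rw [map_mul, mul_apply, Sum.inr_injective hcc, map_inv, ← mul_apply, inv_mul_cancel,
        one_apply]
    · exact absurd hcc Sum.inr_ne_inl
    · exact absurd hcc Sum.inl_ne_inr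
    · have h1 : ρ' (h'⁻¹ * h) (g⁻¹ (T c)) = g⁻¹ (T c') := by
        rw [map_mul, mul_apply, Sum.inl_injective hcc, map_inv, ← mul_apply, inv_mul_cancel,
          one_apply]
      obtain ⟨k, hk, he⟩ := hg (h'⁻¹ * h) (H.mul_mem (H.inv_mem hh') hh)
      refine hT' c c' k hk ?_
      rw [hgood k hk, ← he, mul_apply, mul_apply, h1, ← mul_apply, mul_inv_cancel, one_apply]
  have hle : C ≤ (Sum.inl '' (A ∪ Z) ∪ Sum.inr '' B : Set (Ω ⊕ Ω)).ncard := by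
    rw [← Nat.card_fin C, ← Set.ncard_univ]
    exact Set.ncard_le_ncard_of_injOn b (fun c _ => hb c) hinj.injOn (Set.toFinite _)
  have h1 := Set.ncard_union_le (Sum.inl '' (A ∪ Z) : Set (Ω ⊕ Ω)) (Sum.inr '' B)
  have h2 := Set.ncard_image_le (f := (Sum.inl : Ω → Ω ⊕ Ω)) (Set.toFinite (A ∪ Z))
  have h3 := Set.ncard_image_le (f := (Sum.inr : Ω → Ω ⊕ Ω)) (Set.toFinite B)
  have h4 := Set.ncard_union_le A Z
  omega

/-- Both `p ^ k` and `|α|!` are periods of `u`, and they are coprime since `p > |α|`. -/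
theorem MulAction.smul_eq_of_pow_prime_pow_smul_eq {G α : Type*} [Group G] [MulAction G α]
    [Finite α] {p k : ℕ} (hp : p.Prime) (hcard : Nat.card α < p) {g : G} {u : α}
    (h : g ^ p ^ k • u = u) : g • u = u := by
  classical
  have := Fintype.ofFinite α
  have h1 : Function.IsPeriodicPt (g • · : α → α) (p ^ k) u := by
    rw [Function.IsPeriodicPt, smul_iterate]
    exact h
  have h2 : Function.IsPeriodicPt (g • · : α → α) (Fintype.card (Perm α)) u := by
    rw [Function.IsPeriodicPt, smul_iterate]
    have h3 : MulAction.toPermHom G α g ^ Fintype.card (Perm α) = 1 := pow_card_eq_one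
    rw [← map_pow] at h3
    exact congrArg (fun σ : Perm α => σ u) h3
  have h3 := h1.gcd h2
  have h4 : (p ^ k).gcd (Fintype.card (Perm α)) = 1 := by
    rw [← Nat.coprime_iff_gcd_eq_one]
    refine Nat.Coprime.pow_left k ?_
    rw [Fintype.card_perm, Nat.coprime_factorial_iff hp.ne_one, hp.minFac_eq,
      ← Nat.card_eq_fintype_card]
    exact hcard
  rw [h4] at h3
  exact h3

theorem eq_one_of_pow_eq_one_of_coprime {G : Type*} [Group G] {g : G} {a b : ℕ}
    (h : a.Coprime b) (ha : g ^ a = 1) (hb : g ^ b = 1) : g = 1 := by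
  rw [← orderOf_eq_one_iff]
  exact Nat.eq_one_of_dvd_coprimes h (orderOf_dvd_of_pow_eq_one ha) (orderOf_dvd_of_pow_eq_one hb)

theorem Subgroup.IsConjInto.of_eq_bot {G : Type*} [Group G] {H K : Subgroup G} (h : H = ⊥) :
    H.IsConjInto K :=
  ⟨1, fun g hg => by
    rw [h, Subgroup.mem_bot] at hg
    simp [hg]⟩

theorem exists_injective_primes_gt (k N : ℕ) :
    ∃ p : Fin k → ℕ, Function.Injective p ∧ ∀ j, (p j).Prime ∧ N < p j := by
  refine ⟨fun j => Nat.nth Nat.Prime (N + j), fun i j h => ?_, fun j => ⟨Nat.prime_nth_prime _, ?_⟩⟩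
  · have := Nat.nth_injective Nat.infinite_setOfPred_prime h
    exact Fin.ext (by omega)
  · have := Nat.add_two_le_nth_prime (N + j)
    show N < Nat.nth Nat.Prime (N + j)
    omega

/-- A finite action in which each `H j` has many orbits of `p j`-power points, but no subgroup
`H i` that is not conjugate into `H j` has such points. -/
theorem exists_separating_action {X : Type} [Finite X] {k : ℕ}
    (H : Fin k → Subgroup (FreeGroup X)) (hfg : ∀ i, (H i).FG)
    (hind : ∀ i, ¬ (H i).FiniteIndex) (C B : ℕ) :
    ∃ (E : Type) (_ : Fintype E) (ρ : FreeGroup X →* Perm E) (p : Fin k → ℕ),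
      (∀ j, (p j).Prime ∧ B < p j) ∧
      (∃ e : Fin k → E, Function.Injective e ∧ ∀ v, ∃ l g, ρ g (e l) = v) ∧
      (∀ j, ∃ T : Fin C → E, (∀ c, IsPrimePowerPoint ρ (H j) (p j) (T c)) ∧
        ∀ c c', ∀ h ∈ H j, ρ h (T c) = T c' → c = c') ∧
      ∀ i j, ¬ (H i).IsConjInto (H j) → ∀ v, ¬ IsPrimePowerPoint ρ (H i) (p j) v := by
  classical
  choose K hK t ht using fun l => FreeGroup.exists_finiteIndex_fixedPoints (hfg l) (hind l)
    (fun i : {i // ¬ (H i).IsConjInto (H l)} => H i.1) (fun i => hfg i.1) (fun i => i.2) C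
  choose t ht' htfix using t
  obtain ⟨p, hpinj, hp⟩ := exists_injective_primes_gt k (B + ∑ l, (K l).index)
  have hfact : ∀ l, Fact (p l).Prime := fun l => ⟨(hp l).1⟩
  have hs : ∀ i, ∃ s ∈ H i, H i ≠ ⊥ → s ≠ 1 := fun i => by
    by_cases h : H i = ⊥
    · exact ⟨1, (H i).one_mem, fun h' => absurd h h'⟩
    · obtain ⟨s, hs, hs'⟩ := (H i).bot_or_exists_ne_one.resolve_left h
      exact ⟨s, hs, fun _ => hs'⟩
  choose s hsH hs1 using hs
  choose Q hQg hQf φ hQ hφ using fun l => FreeGroup.exists_pGroup_hom_forall_ne_one (p l)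
    (Set.range s \ {1}) ((Set.finite_range s).subset Set.sdiff_subset) fun h => h.2 rfl
  -- Over a fixed point of `H j` in `F/K j`, the group `H j` acts through a `p j`-group. An `H i`
  -- not conjugate into `H j` moves every point of `F/K j`, a set of fewer than `p j` points. For `l
  -- ≠ j`, the image of `s i` in `Q l` is a nontrivial `p l`-element, which no power `p j ^ n`
  -- kills.
  let M : Fin k → Subgroup (FreeGroup X) := fun l => K l ⊓ (φ l).ker
  have hM : ∀ l, (M l).FiniteIndex := fun l => by
    have := hK l
    infer_instance
  have hMfin : ∀ l, Finite (FreeGroup X ⧸ M l) := fun l => by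
    have := hM l
    infer_instance
  have hKfin : ∀ l, Finite (FreeGroup X ⧸ K l) := fun l => by
    have := hK l
    infer_instance
  let E := Σ l, FreeGroup X ⧸ M l
  have hMK : ∀ l (g g' : FreeGroup X), (g : FreeGroup X ⧸ M l) = g' ↔
      (g : FreeGroup X ⧸ K l) = g' ∧ φ l g = φ l g' := by
    intro l g g'
    rw [QuotientGroup.eq, QuotientGroup.eq, Subgroup.mem_inf, MonoidHom.mem_ker, map_mul, map_inv,
      inv_mul_eq_one]
  refine ⟨E, Fintype.ofFinite E, MulAction.toPermHom (FreeGroup X) E, p,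
    fun j => ⟨(hp j).1, lt_of_le_of_lt (Nat.le_add_right _ _) (hp j).2⟩, ?_, ?_, ?_⟩
  · refine ⟨fun l => ⟨l, ((1 : FreeGroup X) : FreeGroup X ⧸ M l)⟩,
      fun i j h => congrArg Sigma.fst h, ?_⟩
    rintro ⟨l, u⟩
    induction u using QuotientGroup.induction_on with | _ g =>
    refine ⟨l, g, ?_⟩
    show (⟨l, ((g * 1 : FreeGroup X) : FreeGroup X ⧸ M l)⟩ : E) = _
    rw [mul_one]
  · intro j
    refine ⟨fun c => ⟨j, ((t j c).out : FreeGroup X ⧸ M j)⟩, ?_, ?_⟩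
    · intro c h hh
      obtain ⟨k, hk⟩ := hQ j (φ j h)
      refine ⟨k, ?_⟩
      show (⟨j, ((h ^ p j ^ k * (t j c).out : FreeGroup X) : FreeGroup X ⧸ M j)⟩ : E) = _
      congr 1
      rw [hMK]
      constructor
      · have := htfix j c (h ^ p j ^ k) ((H j).pow_mem hh _)
        rw [← QuotientGroup.out_eq' (t j c)] at this
        exact this
      · rw [map_mul, map_pow, hk, one_mul]
    · intro c c' h hh he
      have he : (⟨j, ((h * (t j c).out : FreeGroup X) : FreeGroup X ⧸ M j)⟩ : E) =
        ⟨j, ((t j c').out : FreeGroup X ⧸ M j)⟩ := he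
      have h1 := ((hMK _ _ _).1 (eq_of_heq (Sigma.mk.inj he).2)).1
      rw [QuotientGroup.out_eq'] at h1
      have h2 := htfix j c h hh
      rw [← QuotientGroup.out_eq' (t j c)] at h2
      have h3 : ((h * (t j c).out : FreeGroup X) : FreeGroup X ⧸ K j) = (t j c).out := h2
      rw [h1, QuotientGroup.out_eq'] at h3
      exact (ht' j h3).symm
  · rintro i j hij ⟨l, u⟩ hv
    induction u using QuotientGroup.induction_on with | _ g =>
    have hv' : ∀ h ∈ H i, ∃ n : ℕ, ((h ^ p j ^ n * g : FreeGroup X) : FreeGroup X ⧸ M l) = g := by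
      intro h hh
      obtain ⟨n, hn⟩ := hv h hh
      have hn : (⟨l, ((h ^ p j ^ n * g : FreeGroup X) : FreeGroup X ⧸ M l)⟩ : E) =
        ⟨l, (g : FreeGroup X ⧸ M l)⟩ := hn
      exact ⟨n, eq_of_heq (Sigma.mk.inj hn).2⟩
    by_cases hlj : l = j
    · subst hlj
      obtain ⟨h, hh, hne⟩ := ht l ⟨i, hij⟩ g
      obtain ⟨n, hn⟩ := hv' h hh
      refine hne (MulAction.smul_eq_of_pow_prime_pow_smul_eq (k := n) (hp l).1 ?_
        ((hMK _ _ _).1 hn).1)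
      refine lt_of_le_of_lt ?_ (hp l).2
      refine le_trans ?_ (Nat.le_add_left _ _)
      exact Finset.single_le_sum (f := fun l => (K l).index) (fun _ _ => Nat.zero_le _)
        (Finset.mem_univ l)
    · have hne : s i ≠ 1 := hs1 i fun h => hij (.of_eq_bot h)
      refine hφ l (s i) ⟨⟨i, rfl⟩, hne⟩ ?_
      obtain ⟨n, hn⟩ := hv' (s i) (hsH i)
      have h1 := ((hMK _ _ _).1 hn).2
      rw [map_mul, map_pow, mul_eq_right] at h1
      obtain ⟨m, hm⟩ := hQ l (φ l (s i))
      refine eq_one_of_pow_eq_one_of_coprime ?_ h1 hm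
      exact Nat.Coprime.pow _ _ ((Nat.coprime_primes (hp j).1 (hp l).1).2
        fun h => hlj (hpinj h).symm)

/-! ### Construction of the homomorphism for free groups of finite rank -/

/-- The action on `G × ZMod n` by left translations through homomorphisms to the two factors. -/
def translationHom {F G : Type*} [Group F] [Group G] {n : ℕ} (φ : F →* G)
    (ψ : F →* Multiplicative (ZMod n)) : F →* Perm (G × ZMod n) where
  toFun g := prodCongr (Equiv.mulLeft (φ g)) (Equiv.addLeft (ψ g).toAdd)
  map_one' := by ext w <;> simp
  map_mul' g h := by ext w <;> simp [mul_assoc, add_assoc]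

/-- Take `W = G × ZMod n` with `|G| * n + 1` prime, by the case of Dirichlet's theorem for primes
congruent to 1. The factor `G` is translated freely through `φ`; only `x` moves the factor `ZMod n`.
-/
theorem exists_almost_cycle_action {X G : Type} [DecidableEq X] [Group G] [Fintype G]
    (φ : FreeGroup X →* G) (x : X) (N : ℕ) :
    ∃ (W : Type) (_ : Fintype W) (_ : DecidableEq W) (ρ : FreeGroup X →* Perm W)
      (ξ : Perm (Option W)), (Fintype.card W + 1).Prime ∧ N < Fintype.card W + 1 ∧
      (∀ u v, ∃ n : ℤ, (ξ ^ n) u = v) ∧ ξ ^ (Fintype.card W + 1) = 1 ∧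
      (∀ z, z ≠ x → ρ (.of z) ^ Fintype.card G = 1) ∧ (∀ g w, ρ g w = w → φ g = 1) ∧
      {w | ξ (some w) ≠ some (ρ (.of x) w)}.ncard ≤ Fintype.card G := by
  classical
  obtain ⟨q, hq, hNq, hmod⟩ := Nat.exists_prime_gt_modEq_one (k := Fintype.card G) (N + 1)
    Fintype.card_ne_zero
  obtain ⟨n, hn⟩ := (Nat.modEq_iff_dvd' (by omega)).1 hmod.symm
  have hn0 : NeZero n := ⟨by rintro rfl; omega⟩
  obtain ⟨ξ, h1, h2, h3⟩ := exists_full_cycle_option (φ (.of x)) n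
  let ψ : FreeGroup X →* Multiplicative (ZMod n) :=
    FreeGroup.lift fun z => if z = x then Multiplicative.ofAdd 1 else 1
  have hcard : Fintype.card (G × ZMod n) + 1 = q := by
    rw [Fintype.card_prod, ZMod.card]
    omega
  refine ⟨G × ZMod n, inferInstance, inferInstance, translationHom φ ψ, ξ, hcard ▸ hq, by omega, h1,
    ?_, ?_, ?_, ?_⟩
  · rw [Fintype.card_prod, ZMod.card]
    exact h2
  · intro z hz
    rw [← map_pow]
    ext w
    · simp [translationHom]
    · simp [translationHom, ψ, hz]
  · intro g w hw
    simpa [translationHom] using congrArg Prod.fst hw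
  · refine le_trans (le_of_eq ?_) h3
    congr! 4 with w
    simp [translationHom, ψ, add_comm, Prod.map]

theorem IsPrimePowerPoint.eq_one {F G Ω : Type*} [Group F] [Group G] [Fintype G]
    {ρ : F →* Perm Ω} {φ : F →* G} (hφ : ∀ g v, ρ g v = v → φ g = 1) {H : Subgroup F} {p : ℕ}
    (hp : p.Prime) (hcard : Fintype.card G < p) {v : Ω} (hv : IsPrimePowerPoint ρ H p v) {s : F}
    (hs : s ∈ H) : φ s = 1 := by
  obtain ⟨n, hn⟩ := hv s hs
  have h1 := hφ _ _ hn
  rw [map_pow] at h1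
  refine eq_one_of_pow_eq_one_of_coprime ?_ h1 (pow_card_eq_one (x := φ s))
  exact Nat.Coprime.pow_left _ (Nat.coprime_of_lt_prime Fintype.card_ne_zero hcard hp)

/-- The order of choices avoids circularity: the 3-group `G`, the damage `D` per generator, the
number of orbits wanted, then `E`, `W₁` and `W₂`. -/
theorem FreeGroup.exists_hom_perm {X : Type} [Finite X] {x y : X} (hxy : x ≠ y) {k : ℕ}
    (H : Fin k → Subgroup (FreeGroup X)) (hfg : ∀ i, (H i).FG)
    (hind : ∀ i, ¬ (H i).FiniteIndex) (ε : ℤˣ) :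
    ∃ (m : ℕ) (f : FreeGroup X →* Perm (Fin m)),
      (ε = 1 → f.range = alternatingGroup _) ∧ (ε = -1 → f.range = ⊤) ∧
      ∀ i j, ¬ (H i).IsConjInto (H j) →
        ∀ g : Perm (Fin m), ¬ ∀ h ∈ H i, ∃ h' ∈ H j, g * f h * g⁻¹ = f h' := by
  classical
  have hs : ∀ i, ∃ s ∈ H i, H i ≠ ⊥ → s ≠ 1 := fun i => by
    by_cases h : H i = ⊥
    · exact ⟨1, (H i).one_mem, fun h' => absurd h h'⟩
    · obtain ⟨s, hs, hs'⟩ := (H i).bot_or_exists_ne_one.resolve_left h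
      exact ⟨s, hs, fun _ => hs'⟩
  choose s hsH hs1 using hs
  -- The prime is odd so that permutations of order dividing `|G|` are even.
  have : Fact (Nat.Prime 3) := ⟨Nat.prime_three⟩
  obtain ⟨G, _, _, φ, hG, hφ⟩ := exists_pGroup_hom_forall_ne_one 3
    (Set.range s \ {1}) ((Set.finite_range s).subset Set.sdiff_subset) fun h => h.2 rfl
  have := Fintype.ofFinite G
  have hGodd : Odd (Fintype.card G) := by
    obtain ⟨n, hn⟩ := hG.exists_card_eq
    rw [← Nat.card_eq_fintype_card, hn]
    exact Odd.pow (by decide)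
  choose S hS using hfg
  choose c hc using fun h : FreeGroup X => exists_discrepancy_bound h
  let D := Fintype.card G + 2 * Fintype.card (Fin k ⊕ Fin k) + 3
  let b : Fin k → ℕ := fun i => ∑ s ∈ S i, c s * D
  obtain ⟨E, _, ρ, p, hp, ⟨e, he, hcov⟩, hT, hno⟩ := exists_separating_action H
    (fun i => ⟨S i, hS i⟩) hind (∑ i, b i + ∑ i, b i + 2) (Fintype.card G)
  -- Doubling `E` makes every generator act on it by an even permutation.
  let ρ₀ : FreeGroup X →* Perm (E ⊕ E) := (Perm.sumCongrHom E E).comp (ρ.prod ρ)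
  obtain ⟨W₁, _, _, ρ₁, ξ₁, hq₁, hN₁, hξ₁, hξ₁', hz₁, hW₁, hd₁⟩ := exists_almost_cycle_action φ x
    (Fintype.card (E ⊕ E) + Fintype.card G + Fintype.card (Fin k ⊕ Fin k) + 2)
  obtain ⟨W₂, _, _, ρ₂, ξ₂, hq₂, hN₂, hξ₂, hξ₂', hz₂, hW₂, hd₂⟩ := exists_almost_cycle_action φ y
    (Fintype.card (E ⊕ E) + Fintype.card W₁ + 2)
  obtain ⟨ρ', h1, h2, h3⟩ := exists_amalgam (e := Sum.map e e) (ρ := ρ₀) (ρ₁ := ρ₁) (ρ₂ := ρ₂) hxy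
    (he.sumMap he)
    (by
      rintro (v | v) <;> obtain ⟨l, g, h⟩ := hcov v
      · exact ⟨.inl l, g, congrArg Sum.inl h⟩
      · exact ⟨.inr l, g, congrArg Sum.inr h⟩)
    ξ₁ ξ₂ hξ₁ hξ₂ hξ₁' hξ₂' (hq₁.odd_of_ne_two (by omega)) (hq₂.odd_of_ne_two (by omega)) hq₂
    (a := (Fintype.card (E ⊕ E)).factorial * Fintype.card G)
    (Nat.Coprime.mul_left
      ((Nat.coprime_factorial_iff hq₁.ne_one).2 (by rw [hq₁.minFac_eq]; omega)).symm
      (Nat.coprime_of_lt_prime Fintype.card_ne_zero (by omega) hq₁).symm)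
    (by rw [← Fintype.card_perm, pow_mul, pow_card_eq_one, one_pow])
    (by rw [mul_comm, pow_mul, hz₂ x hxy, one_pow])
    (by omega) (by omega)
    (fun z => (sign_sumCongr _ _).trans (Int.units_mul_self _))
    (fun z hz => sign_eq_one_of_odd_pow_eq_one _ hGodd (hz₁ z hz))
    (fun z hz => sign_eq_one_of_odd_pow_eq_one _ hGodd (hz₂ z hz)) hd₁ hd₂ ε
  let σ := Fintype.equivFin (((E ⊕ E) ⊕ W₁) ⊕ Option W₂)
  let f : FreeGroup X →* Perm (Fin _) := σ.permCongrHom.toMonoidHom.comp ρ'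
  have hb : ∀ i, {v | ∃ s ∈ S i, blockHom ρ₀ ρ₁ ρ₂ s v ≠ ρ' s v}.ncard ≤ b i := by
    intro i
    have : {v | ∃ s ∈ S i, blockHom ρ₀ ρ₁ ρ₂ s v ≠ ρ' s v} =
        ⋃ s ∈ S i, {v | blockHom ρ₀ ρ₁ ρ₂ s v ≠ ρ' s v} := by
      ext v
      simp
    rw [this]
    exact (Finset.set_ncard_biUnion_le _ _).trans (Finset.sum_le_sum fun s _ => hc s _ _ _ h3)
  refine ⟨_, f, fun hε => ?_, fun hε => ?_, fun i j hij g hg => ?_⟩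
  · rw [MonoidHom.range_comp, h1 hε]
    ext τ
    constructor
    · rintro ⟨τ, hτ, rfl⟩
      exact (sign_permCongr σ τ).trans hτ
    · intro hτ
      exact ⟨σ.symm.permCongr τ, (sign_permCongr _ _).trans hτ, σ.permCongrHom.apply_symm_apply τ⟩
  · rw [MonoidHom.range_comp, h2 hε]
    exact Subgroup.map_top_of_surjective _ σ.permCongrHom.surjective
  · obtain ⟨T, hT₁, hT₂⟩ := hT j
    have hbi : b i ≤ ∑ i, b i := Finset.single_le_sum (fun _ _ => Nat.zero_le _) (Finset.mem_univ i)
    have hbj : b j ≤ ∑ i, b i := Finset.single_le_sum (fun _ _ => Nat.zero_le _) (Finset.mem_univ j)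
    have hsi : φ (s i) ≠ 1 := hφ _ ⟨⟨i, rfl⟩, hs1 i fun h => hij (.of_eq_bot h)⟩
    -- The extra point is fixed by the unperturbed action, so it is a `p`-power point of every
    -- subgroup and has to be excepted.
    refine not_conj_of_primePowerPoints (blockHom ρ₀ ρ₁ ρ₂) ρ' (hS i) (hS j) (p := p j)
      (Z := {Sum.inr none}) ?_ (fun c => Sum.inl (Sum.inl (Sum.inl (T c)))) ?_ ?_ ?_
      (σ.symm.permCongr g) ?_
    · rintro (((v | v) | v) | (_ | v)) hvZ hv
      · refine hno i j hij v fun h hh => (hv h hh).imp fun n hn => ?_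
        exact Sum.inl_injective (Sum.inl_injective (Sum.inl_injective hn))
      · refine hno i j hij v fun h hh => (hv h hh).imp fun n hn => ?_
        exact Sum.inr_injective (Sum.inl_injective (Sum.inl_injective hn))
      · refine hsi (IsPrimePowerPoint.eq_one hW₁ (hp j).1 (hp j).2 (v := v) (fun h hh =>
          (hv h hh).imp fun n hn => ?_) (hsH i))
        exact Sum.inr_injective (Sum.inl_injective hn)
      · exact hvZ rfl
      · refine hsi (IsPrimePowerPoint.eq_one hW₂ (hp j).1 (hp j).2 (v := v) (fun h hh =>
          (hv h hh).imp fun n hn => ?_) (hsH i))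
        exact Option.some_injective _ (Sum.inr_injective hn)
    · exact fun c h hh => (hT₁ c h hh).imp fun n hn =>
        congrArg (fun v => Sum.inl (Sum.inl (Sum.inl v))) hn
    · exact fun c c' h hh hcc => hT₂ c c' h hh
        (Sum.inl_injective (Sum.inl_injective (Sum.inl_injective hcc)))
    · rw [Set.ncard_singleton]
      have := hb i
      have := hb j
      simp only [Finset.mem_coe]
      omega
    · intro h hh
      obtain ⟨h', hh', hgh⟩ := hg h hh
      refine ⟨h', hh', ?_⟩
      have := congrArg σ.permCongrHom.symm hgh
      have hf : ∀ u, σ.permCongrHom.symm (f u) = ρ' u :=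
        fun u => σ.permCongrHom.symm_apply_apply _
      rwa [_root_.map_mul, _root_.map_mul, _root_.map_inv, hf, hf] at this

/-! ### Reduction to free groups of finite rank -/

namespace FreeGroup

theorem exists_finset_mem_closure {I : Type*} (h : FreeGroup I) :
    ∃ A : Finset I, h ∈ Subgroup.closure (of '' (A : Set I)) := by
  classical
  induction h using FreeGroup.induction_on with
  | C1 => exact ⟨∅, Subgroup.one_mem _⟩
  | of z => exact ⟨{z}, Subgroup.subset_closure ⟨z, by simp, rfl⟩⟩
  | inv_of z h => exact h.imp fun A hA => Subgroup.inv_mem _ hA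
  | mul g h hg hh =>
    obtain ⟨A, hA⟩ := hg
    obtain ⟨B, hB⟩ := hh
    refine ⟨A ∪ B, Subgroup.mul_mem _ (Subgroup.closure_mono (Set.image_mono ?_) hA)
      (Subgroup.closure_mono (Set.image_mono ?_) hB)⟩ <;> simp

theorem exists_finset_le_closure {I : Type*} {k : ℕ} (H : Fin k → Subgroup (FreeGroup I))
    (hfg : ∀ i, (H i).FG) :
    ∃ A : Finset I, ∀ i, H i ≤ Subgroup.closure (of '' (A : Set I)) := by
  classical
  choose A hA using exists_finset_mem_closure (I := I)
  choose S hS using hfg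
  refine ⟨Finset.univ.biUnion fun i => (S i).biUnion A, fun i => ?_⟩
  rw [← hS i, Subgroup.closure_le]
  intro s hs
  refine Subgroup.closure_mono (Set.image_mono ?_) (hA s)
  intro z hz
  simp only [Finset.coe_biUnion, Set.mem_iUnion]
  exact ⟨i, Finset.mem_coe.2 (Finset.mem_univ i), s, hs, hz⟩

theorem exists_retraction {I : Type*} (B : Finset I) :
    ∃ (r : FreeGroup I →* FreeGroup (Fin B.card)) (j : FreeGroup (Fin B.card) →* FreeGroup I),
      (∀ w, r (j w) = w) ∧ (∀ h ∈ Subgroup.closure (of '' (B : Set I)), j (r h) = h) ∧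
      ∀ b ∈ B, ∃ t, j (of t) = of b := by
  classical
  let r : FreeGroup I →* FreeGroup (Fin B.card) :=
    lift fun z => if h : z ∈ B then of (B.equivFin ⟨z, h⟩) else 1
  let j : FreeGroup (Fin B.card) →* FreeGroup I := lift fun t => of (B.equivFin.symm t).1
  refine ⟨r, j, fun w => ?_, fun h hh => ?_, fun b hb => ⟨B.equivFin ⟨b, hb⟩, by simp [j]⟩⟩
  · have : r.comp j = MonoidHom.id _ := by
      ext t
      simp [r, j]
    exact DFunLike.congr_fun this w
  · refine MonoidHom.eqOn_closure (f := j.comp r) (g := MonoidHom.id _) ?_ hh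
    rintro _ ⟨b, hb, rfl⟩
    have hb : b ∈ B := hb
    simp [r, j, hb]

/-- The exponent sum of `z` vanishes on the subgroup generated by `A`, but is `m` on `z ^ m`. -/
theorem of_pow_notMem_of_le_closure {I : Type*} {A : Set I} {z : I} (hz : z ∉ A)
    {K : Subgroup (FreeGroup I)} (hK : K ≤ Subgroup.closure (of '' A)) {m : ℕ} (hm : 0 < m) :
    of z ^ m ∉ K := by
  classical
  intro hmem
  let χ : FreeGroup I →* Multiplicative ℤ :=
    lift fun t => if t = z then Multiplicative.ofAdd 1 else 1
  have hχ : Subgroup.closure (of '' A) ≤ χ.ker := by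
    rw [Subgroup.closure_le]
    rintro _ ⟨t, ht, rfl⟩
    have : t ≠ z := fun h => hz (h ▸ ht)
    simp [χ, MonoidHom.mem_ker, this]
  have h1 : χ (of z ^ m) = 1 := hχ (hK hmem)
  have h2 : (m : ℤ) = 0 := by simpa [χ, ← ofAdd_nsmul] using h1
  omega

/-- For the index to stay infinite, either every generator is retained and `r` is injective, or some
retained generator lies outside `A`, and no positive power of it belongs to any `H i`. -/
theorem exists_finite_rank_retraction {I : Type*} {a b : I} (hab : a ≠ b) {k : ℕ}
    (H : Fin k → Subgroup (FreeGroup I)) (hfg : ∀ i, (H i).FG)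
    (hind : ∀ i, ¬ (H i).FiniteIndex) :
    ∃ (n : ℕ) (x y : Fin n) (r : FreeGroup I →* FreeGroup (Fin n))
      (j : FreeGroup (Fin n) →* FreeGroup I), x ≠ y ∧ Function.Surjective r ∧
      (∀ i, ∀ h ∈ H i, j (r h) = h) ∧ ∀ i, ¬ ((H i).map r).FiniteIndex := by
  classical
  obtain ⟨A, hA⟩ := exists_finset_le_closure H hfg
  obtain ⟨B, hAB, haB, hbB, hB⟩ : ∃ B : Finset I, A ⊆ B ∧ a ∈ B ∧ b ∈ B ∧
      ((∀ z, z ∈ B) ∨ ∃ z ∈ B, z ∉ A) := by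
    by_cases h : ∀ z, z ∈ A
    · exact ⟨A, subset_rfl, h a, h b, Or.inl h⟩
    · push Not at h
      obtain ⟨z, hz⟩ := h
      refine ⟨insert z (insert a (insert b A)), fun t ht => ?_, ?_, ?_, Or.inr ⟨z, ?_, hz⟩⟩ <;>
        simp [*]
  obtain ⟨r, j, hrj, hjr, hB'⟩ := exists_retraction B
  have hHB : ∀ i, ∀ h ∈ H i, j (r h) = h := fun i h hh =>
    hjr h (Subgroup.closure_mono (Set.image_mono (Finset.coe_subset.2 hAB)) (hA i hh))
  have hr : Function.Surjective r := fun w => ⟨j w, hrj w⟩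
  obtain ⟨x, hx⟩ := hB' a haB
  obtain ⟨y, hy⟩ := hB' b hbB
  refine ⟨_, x, y, r, j, fun h => hab (of_injective (hx ▸ hy ▸ h ▸ rfl)), hr, hHB,
    fun i hi => ?_⟩
  rcases hB with hB | ⟨z, hzB, hzA⟩
  · have hinj : Function.Injective r := by
      refine Function.LeftInverse.injective (g := j) fun h => hjr h ?_
      have : (B : Set I) = Set.univ := Set.eq_univ_of_forall hB
      rw [this, Set.image_univ, closure_range_of]
      trivial
    refine hind i ⟨?_⟩
    rw [← Subgroup.comap_map_eq_self_of_injective hinj (H i),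
      Subgroup.index_comap_of_surjective _ hr]
    exact hi.index_ne_zero
  · obtain ⟨t, ht⟩ := hB' z hzB
    obtain ⟨m, hm, -, h, hh, he⟩ := Subgroup.exists_pow_mem_of_index_ne_zero hi.index_ne_zero (of t)
    have h1 : h = of z ^ m := by rw [← hHB i h hh, he, _root_.map_pow, ht]
    exact of_pow_notMem_of_le_closure hzA (hA i) hm (h1 ▸ hh)

theorem mul_comm_of_subsingleton {I : Type*} [Subsingleton I] (g h : FreeGroup I) :
    g * h = h * g := by
  rcases isEmpty_or_nonempty I with hI | ⟨⟨z⟩⟩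
  · exact Subsingleton.elim _ _
  · have := uniqueOfSubsingleton z
    apply (mulEquivIntOfUnique (α := I)).injective
    rw [_root_.map_mul, _root_.map_mul, mul_comm]

end FreeGroup

theorem Subgroup.FG.map_hom {G G' : Type*} [Group G] [Group G'] {H : Subgroup G} (hH : H.FG)
    (f : G →* G') : (H.map f).FG := by
  classical
  obtain ⟨S, rfl⟩ := hH
  exact ⟨S.image f, by rw [Finset.coe_image, ← MonoidHom.map_closure]⟩

theorem IsFreeGroup.exists_hom_perm {F : Type*} [Group F] [IsFreeGroup F]
    (hF : ∃ a b : F, a * b ≠ b * a) {k : ℕ} (H : Fin k → Subgroup F) (hfg : ∀ i, (H i).FG)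
    (hindex : ∀ i, ¬ (H i).FiniteIndex) (ε : ℤˣ) :
    ∃ (m : ℕ) (f : F →* Perm (Fin m)),
      (ε = 1 → f.range = alternatingGroup _) ∧ (ε = -1 → f.range = ⊤) ∧
      ∀ i j, ¬ (H i).IsConjInto (H j) →
        ∀ g : Perm (Fin m), ¬ ∀ h ∈ H i, ∃ h' ∈ H j, g * f h * g⁻¹ = f h' := by
  let e := IsFreeGroup.toFreeGroup F
  obtain ⟨a, b, hab⟩ : ∃ a b : IsFreeGroup.Generators F, a ≠ b := by
    by_contra! h
    have : Subsingleton (IsFreeGroup.Generators F) := ⟨h⟩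
    obtain ⟨a, b, hab⟩ := hF
    refine hab (e.injective ?_)
    rw [map_mul, map_mul, FreeGroup.mul_comm_of_subsingleton]
  obtain ⟨n, x, y, r, j, hxy, hr, hjr, hind⟩ := FreeGroup.exists_finite_rank_retraction hab
    (fun i => (H i).map e.toMonoidHom) (fun i => Subgroup.FG.map_hom (hfg i) _) (fun i hi => hindex i ⟨by
      rw [← Subgroup.index_map_equiv (H i) e]
      exact hi.index_ne_zero⟩)
  obtain ⟨m, f, h1, h2, h3⟩ := FreeGroup.exists_hom_perm hxy _
    (fun i => Subgroup.FG.map_hom (Subgroup.FG.map_hom (hfg i) e.toMonoidHom) r) hind ε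
  have hsurj : Function.Surjective (r.comp e.toMonoidHom) := hr.comp e.surjective
  have hrange : (f.comp (r.comp e.toMonoidHom)).range = f.range := by
    rw [MonoidHom.range_comp, MonoidHom.range_eq_top.2 hsurj, ← MonoidHom.range_eq_map]
  refine ⟨m, f.comp (r.comp e.toMonoidHom), fun hε => hrange.trans (h1 hε),
    fun hε => hrange.trans (h2 hε), fun i l hil g hg => ?_⟩
  -- As `j` undoes `r` on every `H i`, it carries a conjugacy between the images back to `F`.
  refine h3 i l (fun ⟨w, hw⟩ => hil ⟨e.symm (j w), fun h hh => ?_⟩) g ?_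
  · obtain ⟨_, ⟨h', hh', rfl⟩, he⟩ := hw _ ⟨_, ⟨h, hh, rfl⟩, rfl⟩
    have h4 := congrArg j he
    rw [map_mul, map_mul, map_inv, hjr l _ ⟨h', hh', rfl⟩, hjr i _ ⟨h, hh, rfl⟩] at h4
    have h5 := congrArg e.symm h4
    simp only [map_mul, map_inv, MulEquiv.toMonoidHom_eq_coe, MonoidHom.coe_coe,
      MulEquiv.symm_apply_apply] at h5
    exact h5 ▸ hh'
  · rintro _ ⟨_, ⟨h, hh, rfl⟩, rfl⟩
    obtain ⟨h', hh', he⟩ := hg h hh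
    exact ⟨_, ⟨_, ⟨h', hh', rfl⟩, rfl⟩, he⟩

theorem theoremA {F : Type*} [Group F] [IsFreeGroup F] (hF : ∃ a b : F, a * b ≠ b * a)
    (k : ℕ) (H : Fin k → Subgroup F) (hfg : ∀ i, (H i).FG) (hindex : ∀ i, ¬ (H i).FiniteIndex) :
    (∃ (m : ℕ) (f : F →* alternatingGroup (Fin m)), Function.Surjective f ∧
      ∀ i j, ¬ (H i).IsConjInto (H j) → ¬ ((H i).map f).IsConjInto ((H j).map f)) ∧
    (∃ (m' : ℕ) (f' : F →* Equiv.Perm (Fin m')), Function.Surjective f' ∧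
      ∀ i j, ¬ (H i).IsConjInto (H j) → ¬ ((H i).map f').IsConjInto ((H j).map f')) := by
  constructor
  · obtain ⟨m, f, h1, -, h3⟩ := IsFreeGroup.exists_hom_perm hF H hfg hindex 1
    have hf : ∀ g, f g ∈ alternatingGroup (Fin m) := fun g => h1 rfl ▸ ⟨g, rfl⟩
    refine ⟨m, f.codRestrict _ hf, ?_, fun i j hij ⟨g, hg⟩ => h3 i j hij g fun h hh => ?_⟩
    · rintro ⟨τ, hτ⟩
      rw [← h1 rfl] at hτ
      exact hτ.imp fun g hg => Subtype.ext hg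
    · obtain ⟨h', hh', he⟩ := hg _ ⟨h, hh, rfl⟩
      exact ⟨h', hh', (congrArg Subtype.val he).symm⟩
  · obtain ⟨m, f, -, h2, h3⟩ := IsFreeGroup.exists_hom_perm hF H hfg hindex (-1)
    refine ⟨m, f, MonoidHom.range_eq_top.1 (h2 rfl),
      fun i j hij ⟨g, hg⟩ => h3 i j hij g fun h hh => ?_⟩
    obtain ⟨h', hh', he⟩ := hg _ ⟨h, hh, rfl⟩
    exact ⟨h', hh', he.symm⟩
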